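/- Let $a<b$, $T>0$, $\gamma\in\mathbb R$, $k\ge 0$ an integer, and $f(u)=\tfrac12u^2$. Let $(u,v)$ be a solution on $\mathbb R\times[0,T]$ of $$u_t+f(u)_x+\gamma v=0,\qquad v_x=u,$$ such that $u$ and $v$ are periodic in $x$ with period $b-a$, $\int_a^b v(x,t)\,dx=0$ for all $t\in[0,T]$, and $u$ is of class $C^{k+1}$ in $(x,t)$ on $\mathbb R\times[0,T]$. For a partition $a=x_{1/2}<x_{3/2}<\dots<x_{N+1/2}=b$ with cells $I_j=[x_{j-1/2},x_{j+1/2}]$ and lengths $\Delta x_j$, put $h=\max_j\Delta x_j$, and let $V_h^m$ be the space of functions whose restriction to each $I_j$ is a polynomial of degree at most $m$; $w^-_{j+1/2}$ and $w^+_{j+1/2}$ denote the values at $x_{j+1/2}$ from $I_j$ and from $I_{j+1}$, with $I_{N+1}$ identified with $I_1$ and $I_0$ with $I_N$ by periodicity. A pair $u_h(\cdot,t)\in V_h^k$, $v_h(\cdot,t)\in V_h^{k+1}$, $0\le t\le T$, with $u_h$ differentiable in $t$, solves the (semi-discrete, energy stable) integration DG scheme if for all $t\in[0,T]$, all $j$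 and all $\phi\in V_h^k$ $$\int_{I_j}(u_h)_t\,\phi\,dx+\widehat f_{j+1/2}\,\phi^-_{j+1/2}-\widehat f_{j-1/2}\,\phi^+_{j-1/2}-\int_{I_j}f(u_h)\,\phi_x\,dx+\gamma\int_{I_j}v_h\,\phi\,dx=0,$$ $$v_h(x,t)=v_h(x_{j+1/2},t)-\int_x^{x_{j+1/2}}u_h(\xi,t)\,d\xi\quad(x\in I_j),$$ where $v_h(\cdot,t)$ is continuous on $[a,b]$ with $\int_a^bv_h\,dx=0$, and $\widehat f$ is the Lax–Friedrichs flux $$\widehat f=\tfrac12\bigl(f(u_h^+)+f(u_h^-)-\alpha(u_h^+-u_h^-)\bigr),\qquad \alpha=\alpha(t)=\max_{x\in[a,b]}|f'(u_h(x,t))|$$ (the maximum including both one-sided values at the nodes). Then for all $\rho>0$ and $C_0$ there are constants $C>0$ and $h_0>0$, depending only on $a,b,T,\gamma,k,\rho,C_0$ and the solution $(u,v)$, such that for every partition with $\Delta x_j\ge\rho h$ for all $j$ and $h\le h_0$, and every solution $(u_h,v_h)$ of the scheme on $[0,T]$ with $\|u(\cdot,0)-u_h(\cdot,0)\|_{L^2(a,b)}\le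 C_0h^{k+1/2}$, $$\|u(\cdot,t)-u_h(\cdot,t)\|_{L^2(a,b)}\le C\,h^{k+1/2}\qquad\text{for all }t\in[0,T].$$ -/

import Mathlib

open Set Polynomial

noncomputable section

namespace OV

/-- The nonlinear flux `f(u) = u² / 2`. -/
def flux (w : ℝ) : ℝ := w ^ 2 / 2

/-- `(u, v)` is a classical solution on `ℝ × [0, T]` of
`u_t + f(u)_x + γ v = 0`, `v_x = u`, periodic in space with period `b - a` and with `v` of zero mean
over a period. Functions are written `u x t`; the time derivative is one-sided at `t = 0` and `t = T`.
The first `n` derivatives of `u` in `(x, t)` exist and are continuous up to the times `0` and `T`. -/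
structure IsPeriodicSolution (a b T γ : ℝ) (n : ℕ) (u v : ℝ → ℝ → ℝ) : Prop where
  smooth : ContDiffOn ℝ n (fun p : ℝ × ℝ => u p.1 p.2) (univ ×ˢ Icc 0 T)
  periodic_u : ∀ t ∈ Icc 0 T, Function.Periodic (fun x => u x t) (b - a)
  periodic_v : ∀ t ∈ Icc 0 T, Function.Periodic (fun x => v x t) (b - a)
  evolution : ∀ x, ∀ t ∈ Icc 0 T,
    derivWithin (fun s => u x s) (Icc 0 T) t + deriv (fun y => flux (u y t)) x + γ * v x t = 0
  deriv_v : ∀ x, ∀ t ∈ Icc 0 T, HasDerivAt (fun y => v y t) (u x t) x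
  mean_v : ∀ t ∈ Icc 0 T, ∫ x in a..b, v x t = 0

/-- A partition `a = x_{1/2} < x_{3/2} < ⋯ < x_{N+1/2} = b` of `[a, b]` into `N` cells. -/
structure Mesh (a b : ℝ) where
  N : ℕ
  node : Fin (N + 1) → ℝ
  node_zero : node 0 = a
  node_last : node (Fin.last N) = b
  strictMono : StrictMono node

namespace Mesh

variable {a b : ℝ} (M : Mesh a b)

/-- Left end point of the cell `j`. -/
def left (j : Fin M.N) : ℝ := M.node j.castSucc

/-- Right end point of the cell `j`. -/
def right (j : Fin M.N) : ℝ := M.node j.succ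

/-- Length of the cell `j`. -/
def size (j : Fin M.N) : ℝ := M.right j - M.left j

/-- The mesh size: the largest cell length. -/
def h : ℝ := ⨆ j, M.size j

/-- Regularity of the partition with constant `ρ`: all cell lengths are comparable to the mesh size. -/
def IsRegular (ρ : ℝ) : Prop := ∀ j, ρ * M.h ≤ M.size j

/-- The next cell to the right, cyclically. -/
def next (j : Fin M.N) : Fin M.N := finRotate M.N j

/-- The next cell to the left, cyclically. -/
def prev (j : Fin M.N) : Fin M.N := (finRotate M.N).symm j

/-- A family of polynomials, one on each (closed) cell; a discontinuous piecewise polynomial has two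
values at every interface, one from each of the adjacent cells. -/
abbrev Broken : Type := Fin M.N → ℝ[X]

/-- Membership in the finite element space `V_h^k`: degree at most `k` on each cell. -/
def InV (k : ℕ) (w : M.Broken) : Prop := ∀ j, (w j).natDegree ≤ k

/-- Trace `w⁻` at the right end point of the cell `j`, taken from the cell `j`. -/
def traceMinus (w : M.Broken) (j : Fin M.N) : ℝ := (w j).eval (M.right j)

/-- Trace `w⁺` at the right end point of the cell `j`, taken from the following cell
(periodically: after the last cell comes the first one). -/
def tracePlus (w : M.Broken) (j : Fin M.N) : ℝ := (w (M.next j)).eval (M.left (M.next j))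

/-- The Lax-Friedrichs viscosity `α = max |f'(w)|`, the maximum over all values of `w`. -/
def alpha (w : M.Broken) : ℝ :=
  sSup {r | ∃ j, ∃ x ∈ Icc (M.left j) (M.right j), r = |deriv flux ((w j).eval x)|}

/-- The Lax-Friedrichs flux at the right end point of the cell `j`. -/
def numFlux (w : M.Broken) (j : Fin M.N) : ℝ :=
  (flux (M.tracePlus w j) + flux (M.traceMinus w j)
    - M.alpha w * (M.tracePlus w j - M.traceMinus w j)) / 2

/-- The boundary bracket `⟨f̂(w), φ⟩` on the cell `j`. -/
def bracket (w : M.Broken) (φ : ℝ[X]) (j : Fin M.N) : ℝ :=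
  M.numFlux w j * φ.eval (M.right j) - M.numFlux w (M.prev j) * φ.eval (M.left j)

/-- The `L²(a, b)` distance of a function to a piecewise polynomial. -/
def l2Error (g : ℝ → ℝ) (w : M.Broken) : ℝ :=
  √(∑ j, ∫ x in M.left j..M.right j, (g x - (w j).eval x) ^ 2)

/-- `(uh, vh)` solves the semi-discrete energy stable integration DG scheme on `[0, T]` with periodic
boundary conditions: `uh t ∈ V_h^k`, `vh t ∈ V_h^{k+1}`, `vh` is continuous, has zero mean and is
obtained by integrating `uh`.
(If `uh` has zero mean at time `0`, it keeps it, and then `vh` takes equal values at `a` and `b`.) -/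
structure IsIntegrationDG (T γ : ℝ) (k : ℕ) (uh vh : ℝ → M.Broken) : Prop where
  mem_u : ∀ t ∈ Icc 0 T, M.InV k (uh t)
  mem_v : ∀ t ∈ Icc 0 T, M.InV (k + 1) (vh t)
  /-- The degrees of freedom of `uh` are differentiable in time. -/
  differentiable : ∀ j i, DifferentiableOn ℝ (fun s => (uh s j).coeff i) (Icc 0 T)
  weak_form : ∀ t ∈ Icc 0 T, ∀ φ : ℝ[X], φ.natDegree ≤ k → ∀ j,
    (∫ x in M.left j..M.right j,
        derivWithin (fun s => (uh s j).eval x) (Icc 0 T) t * φ.eval x)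
      + M.bracket (uh t) φ j
      - (∫ x in M.left j..M.right j, flux ((uh t j).eval x) * (derivative φ).eval x)
      + γ * (∫ x in M.left j..M.right j, (vh t j).eval x * φ.eval x) = 0
  integral_v : ∀ t ∈ Icc 0 T, ∀ j, ∀ x ∈ Icc (M.left j) (M.right j),
    (vh t j).eval x = (vh t j).eval (M.right j) - ∫ y in x..M.right j, (uh t j).eval y
  continuous_v : ∀ t ∈ Icc 0 T, ∀ i j : Fin M.N, (j : ℕ) = i + 1 →
    (vh t i).eval (M.right i) = (vh t j).eval (M.left j)
  mean_v : ∀ t ∈ Icc 0 T, ∑ j, ∫ x in M.left j..M.right j, (vh t j).eval x = 0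

end Mesh

end OV

end

noncomputable section

namespace OV

/-! ### Smooth functions on a space-time strip -/

section Strip

variable {T : ℝ} {g : ℝ × ℝ → ℝ}

/-! On each cell let `P` be the L² projection of `u`, and split the error as `e = u - u_h = ξ - η`
with `ξ = P - u_h` and `η = P - u = O(h^{k+1})`. Testing the scheme with `ξ` and using Grönwall's
inequality proves the theorem, once the rate `∫ e e_t` is bounded by `C (‖e‖² + h^{2k+1})`.

Three points shape the argument. Since `u` is only `C^{k+1}`, the energy is `‖e‖²` and not `‖ξ‖²`,
so that `P` is never differentiated in time. In `∫ η e_t` orthogonality replaces `e_t` by `u_t`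
minus a polynomial, which is `O(h^k)`, and the product is of order `h^{2k+1}`
(`IsL2Projection.integral_mul_error_le`).

The flux being quadratic, `f(u) - f(u_h)` expands exactly in `ξ` and `η`. The terms in `ξ` alone are
total derivatives up to `u_x ξ²/2`, and those containing `η` form `consistency`, small by
orthogonality and inverse inequalities. What is left sits at the interfaces (`cell_energy_identity`,
`Mesh.energy_identity`).

At an interface the cubic term in the jump of `ξ` is absorbed by the Lax–Friedrichs viscosity,
because the jump of `u_h` is at most `2α` (`interface_estimate`). No a priori bound on `u_h` is
therefore needed, and mesh size at most 1 suffices. The remainder `α ε²` with `ε = O(h^{k+1})`,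
summed over `O(1/h)` interfaces, is the source of the rate `h^{k+1/2}`. The nonlocal term is
harmless: `v - v_h` is an antiderivative of `e`, normalised by its mean
(`Mesh.sq_antiderivative_error_le`). -/

theorem uniqueDiffOn_strip (hT : 0 < T) :
    UniqueDiffOn ℝ ((univ : Set ℝ) ×ˢ Icc (0 : ℝ) T) :=
  uniqueDiffOn_univ.prod (uniqueDiffOn_Icc hT)

/-- Derivative of a function on the strip `ℝ × [0, T]` in the direction `e`. -/
def stripDeriv (T : ℝ) (e : ℝ × ℝ) (g : ℝ × ℝ → ℝ) (p : ℝ × ℝ) : ℝ :=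
  fderivWithin ℝ g (univ ×ˢ Icc 0 T) p e

theorem contDiffOn_stripDeriv (hT : 0 < T) {n : ℕ}
    (hg : ContDiffOn ℝ (n + 1 : ℕ) g (univ ×ˢ Icc 0 T)) (e : ℝ × ℝ) :
    ContDiffOn ℝ n (stripDeriv T e g) (univ ×ˢ Icc 0 T) :=
  (hg.fderivWithin (uniqueDiffOn_strip hT) (by norm_cast)).clm_apply contDiffOn_const

theorem hasDerivAt_space {n : ℕ} (hg : ContDiffOn ℝ (n + 1 : ℕ) g (univ ×ˢ Icc 0 T))
    {x t : ℝ} (ht : t ∈ Icc 0 T) :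
    HasDerivAt (fun y => g (y, t)) (stripDeriv T (1, 0) g (x, t)) x := by
  have h1 : HasFDerivWithinAt g (fderivWithin ℝ g (univ ×ˢ Icc 0 T) (x, t))
      (univ ×ˢ Icc 0 T) (x, t) :=
    (hg.differentiableOn (by norm_cast) (x, t) ⟨mem_univ _, ht⟩).hasFDerivWithinAt
  have h2 : HasDerivWithinAt (fun y : ℝ => (y, t)) ((1 : ℝ), (0 : ℝ)) univ x :=
    (hasDerivWithinAt_id x univ).prodMk (hasDerivWithinAt_const _ _ _)
  have h3 : MapsTo (fun y : ℝ => (y, t)) univ (univ ×ˢ Icc 0 T) := fun y _ => ⟨mem_univ _, ht⟩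
  exact hasDerivWithinAt_univ.1 (h1.comp_hasDerivWithinAt x h2 h3)

theorem hasDerivWithinAt_time {n : ℕ} (hg : ContDiffOn ℝ (n + 1 : ℕ) g (univ ×ˢ Icc 0 T))
    {x t : ℝ} (ht : t ∈ Icc 0 T) :
    HasDerivWithinAt (fun s => g (x, s)) (stripDeriv T (0, 1) g (x, t)) (Icc 0 T) t := by
  have h1 : HasFDerivWithinAt g (fderivWithin ℝ g (univ ×ˢ Icc 0 T) (x, t))
      (univ ×ˢ Icc 0 T) (x, t) :=
    (hg.differentiableOn (by norm_cast) (x, t) ⟨mem_univ _, ht⟩).hasFDerivWithinAt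
  have h2 : HasDerivWithinAt (fun s : ℝ => (x, s)) ((0 : ℝ), (1 : ℝ)) (Icc 0 T) t :=
    (hasDerivWithinAt_const _ _ _).prodMk (hasDerivWithinAt_id t _)
  exact h1.comp_hasDerivWithinAt t h2 (fun y hy => ⟨mem_univ _, hy⟩)

theorem exists_bound_on_strip (hg : ContinuousOn g (univ ×ˢ Icc 0 T)) (a b : ℝ) :
    ∃ C, 0 ≤ C ∧ ∀ t ∈ Icc 0 T, ∀ x ∈ Icc a b, |g (x, t)| ≤ C := by
  obtain ⟨C, hC⟩ := (isCompact_Icc.prod isCompact_Icc).exists_bound_of_continuousOn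
    (hg.mono (prod_mono (subset_univ (Icc a b)) Subset.rfl))
  exact ⟨max C 0, le_max_right _ _, fun t ht x hx => (hC (x, t) ⟨hx, ht⟩).trans (le_max_left _ _)⟩

theorem continuous_space_slice (hg : ContinuousOn g (univ ×ˢ Icc 0 T)) {t : ℝ} (ht : t ∈ Icc 0 T) :
    Continuous fun x => g (x, t) := by
  rw [← continuousOn_univ]
  exact hg.comp (by fun_prop) (fun x _ => ⟨mem_univ _, ht⟩)

end Strip

/-! ### Polynomial approximation -/

theorem exists_polynomial_antiderivative {n : ℕ} {q : ℝ[X]} (hq : q.degree < n) :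
    ∃ Q : ℝ[X], Q.degree < (n + 1 : ℕ) ∧ derivative Q = q := by
  refine ⟨∑ i ∈ Finset.range n, monomial (i + 1) (q.coeff i / (i + 1)), ?_, ?_⟩
  · rw [← mem_degreeLT]
    refine Submodule.sum_mem _ fun i hi => ?_
    rw [mem_degreeLT]
    refine (degree_monomial_le _ _).trans_lt ?_
    have := Finset.mem_range.1 hi
    exact_mod_cast Nat.succ_lt_succ this
  · rw [derivative_sum]
    ext m
    simp only [derivative_monomial, finsetSum_coeff, coeff_monomial]
    by_cases hm : m < n
    · rw [Finset.sum_eq_single m]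
      · have : (m : ℝ) + 1 ≠ 0 := by positivity
        simp
        field_simp
      · intro j _ hj
        simp [hj]
      · intro h; exact absurd (Finset.mem_range.2 hm) h
    · rw [Finset.sum_eq_zero, coeff_eq_zero_of_degree_lt]
      · exact hq.trans_le (by exact_mod_cast not_lt.1 hm)
      · intro i hi
        have := Finset.mem_range.1 hi
        rw [if_neg (by simp; omega)]

/-- Taylor type approximation, uniform in time, by polynomials in the space variable. -/
theorem exists_polynomial_approx {T : ℝ} (hT : 0 < T) (a b : ℝ) (n : ℕ) :
    ∀ g : ℝ × ℝ → ℝ, ContDiffOn ℝ n g (univ ×ˢ Icc 0 T) →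
    ∃ C, 0 ≤ C ∧ ∀ t ∈ Icc 0 T, ∀ l r : ℝ, l ≤ r → Icc l r ⊆ Icc a b →
      ∃ q : ℝ[X], q.degree < n ∧ ∀ x ∈ Icc l r, |g (x, t) - q.eval x| ≤ C * (r - l) ^ n := by
  induction n with
  | zero =>
    intro g hg
    obtain ⟨C, hC0, hC⟩ := exists_bound_on_strip hg.continuousOn a b
    -- Degree below 0 forces the zero polynomial, so order 0 is mere boundedness.
    refine ⟨C, hC0, fun t ht l r _ hlr => ⟨0, by simp, fun x hx => ?_⟩⟩
    simpa using hC t ht x (hlr hx)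
  | succ n ih =>
    intro g hg
    obtain ⟨C, hC0, hC⟩ := ih _ (contDiffOn_stripDeriv hT hg (1, 0))
    refine ⟨C, hC0, fun t ht l r hle hlr => ?_⟩
    obtain ⟨q, hqd, hq⟩ := hC t ht l r hle hlr
    obtain ⟨Q, hQd, hQ⟩ := exists_polynomial_antiderivative hqd
    -- An antiderivative of the approximation of the space derivative, normalised to agree with `g`
    -- at `l`; the mean value inequality then gains one factor `r - l`.
    refine ⟨Q + Polynomial.C (g (l, t) - Q.eval l), ?_, fun x hx => ?_⟩
    · refine (degree_add_le _ _).trans_lt (max_lt hQd ?_)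
      exact degree_C_le.trans_lt (by exact_mod_cast Nat.succ_pos n)
    · have hd : ∀ y ∈ Icc l r, HasDerivWithinAt (fun y => g (y, t) - Q.eval y)
          (stripDeriv T (1, 0) g (y, t) - q.eval y) (Icc l r) y := by
        intro y _
        have h1 := (hasDerivAt_space hg (x := y) ht).sub (Q.hasDerivAt y)
        rw [hQ] at h1
        exact h1.hasDerivWithinAt
      have := (convex_Icc l r).norm_image_sub_le_of_norm_hasDerivWithin_le hd
        (fun y hy => hq y hy) (left_mem_Icc.2 hle) hx
      simp only [Real.norm_eq_abs] at this
      calc |g (x, t) - (Q + Polynomial.C (g (l, t) - Q.eval l)).eval x|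
          = |g (x, t) - Q.eval x - (g (l, t) - Q.eval l)| := by
            congr 1; simp; ring
        _ ≤ C * (r - l) ^ n * |x - l| := this
        _ ≤ C * (r - l) ^ n * (r - l) := by
            have : 0 ≤ r - l := sub_nonneg.2 hle
            gcongr
            rw [abs_of_nonneg (sub_nonneg.2 hx.1)]
            linarith [hx.2]
        _ = C * (r - l) ^ (n + 1) := by ring

/-! ### Inverse inequalities -/

theorem intervalIntegral_sq_pos {l r : ℝ} (hlr : l < r) {p : ℝ[X]} (hp : p ≠ 0) :
    0 < ∫ x in l..r, p.eval x ^ 2 := by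
  have hex : ∃ c ∈ Icc l r, p.eval c ≠ 0 := by
    by_contra hcon
    push Not at hcon
    refine hp (Polynomial.eq_zero_of_infinite_isRoot p ((Icc_infinite hlr).mono ?_))
    intro x hx
    exact hcon x hx
  obtain ⟨c, hc, hcp⟩ := hex
  exact intervalIntegral.integral_pos hlr (by fun_prop) (fun x _ => sq_nonneg _)
    ⟨c, hc, by positivity⟩

/-- The polynomial with coefficient vector `c`. -/
def polyOfCoeffs {n : ℕ} (c : Fin n → ℝ) : ℝ[X] := ∑ i : Fin n, monomial (i : ℕ) (c i)

theorem polyOfCoeffs_coeff {p : ℝ[X]} {k : ℕ} (hp : p.natDegree ≤ k) :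
    polyOfCoeffs (fun i : Fin (k + 1) => p.coeff i) = p := by
  unfold polyOfCoeffs
  rw [Fin.sum_univ_eq_sum_range (fun i => monomial i (p.coeff i)) (k + 1)]
  exact (p.as_sum_range' (k + 1) (by omega)).symm

theorem eval_polyOfCoeffs {n : ℕ} (c : Fin n → ℝ) (x : ℝ) :
    (polyOfCoeffs c).eval x = ∑ i : Fin n, c i * x ^ (i : ℕ) := by
  simp [polyOfCoeffs, eval_finsetSum]

/-- Equivalence of norms in finite dimension: the integral is continuous, homogeneous of degree 2
and positive on the compact unit sphere. The sphere is empty exactly when `n = 0`. -/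
theorem exists_coeff_bound (n : ℕ) :
    ∃ m > 0, ∀ c : Fin n → ℝ, m * ‖c‖ ^ 2 ≤ ∫ x in (0 : ℝ)..1, (polyOfCoeffs c).eval x ^ 2 := by
  have hcont : Continuous fun c : Fin n → ℝ => ∫ x in (0 : ℝ)..1, (polyOfCoeffs c).eval x ^ 2 := by
    apply intervalIntegral.continuous_parametric_intervalIntegral_of_continuous'
    simp only [Function.uncurry_def, eval_polyOfCoeffs]
    fun_prop
  have hsmul : ∀ (s : ℝ) (c : Fin n → ℝ), ∫ x in (0 : ℝ)..1, (polyOfCoeffs (s • c)).eval x ^ 2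
      = s ^ 2 * ∫ x in (0 : ℝ)..1, (polyOfCoeffs c).eval x ^ 2 := by
    intro s c
    rw [← intervalIntegral.integral_const_mul]
    congr 1
    ext x
    simp only [eval_polyOfCoeffs, Pi.smul_apply, smul_eq_mul, mul_assoc, ← Finset.mul_sum]
    ring
  rcases (Metric.sphere (0 : Fin n → ℝ) 1).eq_empty_or_nonempty with hS | hS
  · refine ⟨1, one_pos, fun c => ?_⟩
    have hc : c = 0 := by
      by_contra hc
      have : ‖c‖⁻¹ • c ∈ Metric.sphere (0 : Fin n → ℝ) 1 := by
        simp [norm_smul, hc]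
      rw [hS] at this
      exact this
    simp [hc, intervalIntegral.integral_nonneg zero_le_one (fun x _ => sq_nonneg _)]
  · obtain ⟨c₀, hc₀, hmin⟩ :=
      (isCompact_sphere (0 : Fin n → ℝ) 1).exists_isMinOn hS hcont.continuousOn
    refine ⟨_, intervalIntegral_sq_pos zero_lt_one (p := polyOfCoeffs c₀) ?_, fun c => ?_⟩
    · intro h0
      have : c₀ = 0 := by
        ext i
        have := congrArg (fun p => p.coeff (i : ℕ)) h0
        simp only [polyOfCoeffs, finsetSum_coeff, coeff_monomial, coeff_zero] at this
        rw [Finset.sum_eq_single i] at this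
        · simpa using this
        · intro j _ hj
          rw [if_neg (fun h => hj (Fin.ext h))]
        · simp
      rw [this] at hc₀
      simp at hc₀
    · by_cases hc : c = 0
      · simp [hc, intervalIntegral.integral_nonneg zero_le_one (fun x _ => sq_nonneg _)]
      · have hn : 0 < ‖c‖ := norm_pos_iff.2 hc
        have := hmin (show ‖c‖⁻¹ • c ∈ Metric.sphere (0 : Fin n → ℝ) 1 by
          simp [norm_smul, hc])
        simp only [mem_ofPred_eq, hsmul] at this
        calc _ ≤ _ := mul_le_mul_of_nonneg_right this (sq_nonneg ‖c‖)
          _ = _ := by field_simp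

theorem exists_inverse_bound_unit (k : ℕ) :
    ∃ K > 0, ∀ p : ℝ[X], p.natDegree ≤ k → ∀ x ∈ Icc (0 : ℝ) 1,
      p.eval x ^ 2 ≤ K * (∫ y in (0 : ℝ)..1, p.eval y ^ 2) ∧
      (derivative p).eval x ^ 2 ≤ K * (∫ y in (0 : ℝ)..1, p.eval y ^ 2) := by
  obtain ⟨m, hm, hc⟩ := exists_coeff_bound (k + 1)
  -- The value and the derivative are both sums of `k + 1` terms, each at most `(k + 1) * ‖c‖` on
  -- the unit interval, so one constant serves both.
  refine ⟨((k + 1) * (k + 1)) ^ 2 / m, by positivity, fun p hp x hx => ?_⟩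
  set c : Fin (k + 1) → ℝ := fun i => p.coeff i with hcdef
  have hpc := hc c
  have hpe : polyOfCoeffs c = p := polyOfCoeffs_coeff hp
  rw [hpe] at hpc
  have hxp : ∀ i : ℕ, |x ^ i| ≤ 1 := fun i => by
    rw [abs_of_nonneg (pow_nonneg hx.1 _)]; exact pow_le_one₀ hx.1 hx.2
  have hci : ∀ i : Fin (k + 1), |c i| ≤ ‖c‖ := fun i => norm_le_pi_norm c i
  have key : ∀ s : ℝ, |s| ≤ (k + 1) * (k + 1) * ‖c‖ →
      s ^ 2 ≤ ((k + 1) * (k + 1)) ^ 2 / m * (∫ y in (0 : ℝ)..1, p.eval y ^ 2) := by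
    intro s hs
    calc s ^ 2 = |s| ^ 2 := (sq_abs s).symm
      _ ≤ ((k + 1) * (k + 1) * ‖c‖) ^ 2 := by gcongr
      _ = ((k + 1) * (k + 1)) ^ 2 / m * (m * ‖c‖ ^ 2) := by field_simp
      _ ≤ _ := by gcongr
  constructor
  · apply key
    rw [← hpe, eval_polyOfCoeffs]
    calc |∑ i : Fin (k + 1), c i * x ^ (i : ℕ)|
        ≤ ∑ i : Fin (k + 1), |c i * x ^ (i : ℕ)| := Finset.abs_sum_le_sum_abs _ _
      _ ≤ ∑ _i : Fin (k + 1), (k + 1) * ‖c‖ := by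
          refine Finset.sum_le_sum fun i _ => ?_
          rw [abs_mul]
          have h1 : (1 : ℝ) ≤ k + 1 := by simp
          calc |c i| * |x ^ (i : ℕ)| ≤ ‖c‖ * 1 :=
                mul_le_mul (hci i) (hxp i) (abs_nonneg _) (norm_nonneg _)
            _ ≤ (k + 1) * ‖c‖ := by nlinarith [norm_nonneg c]
      _ = (k + 1) * (k + 1) * ‖c‖ := by simp; ring
  · apply key
    have : (derivative p).eval x = ∑ i : Fin (k + 1), c i * i * x ^ ((i : ℕ) - 1) := by
      conv_lhs => rw [← hpe]
      simp [polyOfCoeffs, eval_finsetSum, derivative_monomial]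
    rw [this]
    calc |∑ i : Fin (k + 1), c i * i * x ^ ((i : ℕ) - 1)|
        ≤ ∑ i : Fin (k + 1), |c i * i * x ^ ((i : ℕ) - 1)| := Finset.abs_sum_le_sum_abs _ _
      _ ≤ ∑ _i : Fin (k + 1), (k + 1) * ‖c‖ := by
          refine Finset.sum_le_sum fun i _ => ?_
          rw [abs_mul, abs_mul]
          have h1 : |((i : ℕ) : ℝ)| ≤ k + 1 := by
            rw [abs_of_nonneg (by positivity)]
            exact_mod_cast i.2.le
          calc |c i| * |((i : ℕ) : ℝ)| * |x ^ ((i : ℕ) - 1)| ≤ ‖c‖ * (k + 1) * 1 := by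
                gcongr
                · exact hci i
                · exact hxp _
            _ = (k + 1) * ‖c‖ := by ring
      _ = (k + 1) * (k + 1) * ‖c‖ := by simp; ring

/-- Inverse inequalities: pointwise bounds of a polynomial and of its derivative by the
`L²` norm. -/
theorem exists_inverse_bound (k : ℕ) :
    ∃ K > 0, ∀ l r : ℝ, l < r → ∀ p : ℝ[X], p.natDegree ≤ k → ∀ x ∈ Icc l r,
      (r - l) * p.eval x ^ 2 ≤ K * (∫ y in l..r, p.eval y ^ 2) ∧
      (r - l) ^ 3 * (derivative p).eval x ^ 2 ≤ K * (∫ y in l..r, p.eval y ^ 2) := by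
  obtain ⟨K, hK, h⟩ := exists_inverse_bound_unit k
  refine ⟨K, hK, fun l r hlr p hp x hx => ?_⟩
  have hd : 0 < r - l := sub_pos.2 hlr
  set q : ℝ[X] := p.comp (Polynomial.C (r - l) * X + Polynomial.C l) with hq
  have hqdeg : q.natDegree ≤ k := by
    rw [hq, natDegree_comp, natDegree_linear hd.ne', mul_one]; exact hp
  have hqe : ∀ y, q.eval y = p.eval ((r - l) * y + l) := by intro y; simp [hq]
  have hint : (r - l) * ∫ y in (0 : ℝ)..1, q.eval y ^ 2 = ∫ y in l..r, p.eval y ^ 2 := by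
    simp only [hqe]
    have := intervalIntegral.mul_integral_comp_mul_add (a := 0) (b := 1)
      (f := fun y => p.eval y ^ 2) (r - l) l
    rw [this]; congr 1 <;> ring
  set y := (x - l) / (r - l) with hy
  have hyx : (r - l) * y + l = x := by rw [hy]; field_simp; ring
  have hy01 : y ∈ Icc (0 : ℝ) 1 := by
    refine ⟨div_nonneg (by linarith [hx.1]) hd.le, ?_⟩
    rw [hy, div_le_one hd]; linarith [hx.2]
  obtain ⟨h1, h2⟩ := h q hqdeg y hy01
  have hqd : (derivative q).eval y = (r - l) * (derivative p).eval x := by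
    rw [hq, derivative_comp]; simp [hyx]
  rw [hqe, hyx] at h1
  rw [hqd] at h2
  rw [← hint]
  constructor
  · calc _ ≤ (r - l) * (K * ∫ y in (0 : ℝ)..1, q.eval y ^ 2) := by gcongr
      _ = _ := by ring
  · calc _ = (r - l) * ((r - l) * (derivative p).eval x) ^ 2 := by ring
      _ ≤ (r - l) * (K * ∫ y in (0 : ℝ)..1, q.eval y ^ 2) := by gcongr
      _ = _ := by ring

/-! ### The `L²` projection on a cell -/

theorem natDegree_le_iff_degree_lt_succ {p : ℝ[X]} {k : ℕ} :
    p.natDegree ≤ k ↔ p.degree < (k + 1 : ℕ) := by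
  rw [natDegree_le_iff_degree_le]
  exact (Order.lt_succ_iff (b := (k : WithBot ℕ))).symm

/-- The L² pairing maps polynomials of bounded degree to their dual. It is injective by positivity,
hence surjective by dimension, and so represents the functional `φ ↦ ∫ g φ`. -/
theorem exists_l2_projection (k : ℕ) {l r : ℝ} (hlr : l < r) {g : ℝ → ℝ} (hg : Continuous g) :
    ∃ P : ℝ[X], P.natDegree ≤ k ∧ ∀ φ : ℝ[X], φ.natDegree ≤ k →
      ∫ x in l..r, (P.eval x - g x) * φ.eval x = 0 := by
  let W := degreeLT ℝ (k + 1)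
  have hmem : ∀ p : ℝ[X], p ∈ W ↔ p.natDegree ≤ k := fun p => by
    rw [mem_degreeLT, natDegree_le_iff_degree_lt_succ]
  have hadd : ∀ (w : ℝ → ℝ), Continuous w → ∀ p q : ℝ[X], ∫ x in l..r, w x * (p + q).eval x =
      (∫ x in l..r, w x * p.eval x) + ∫ x in l..r, w x * q.eval x := by
    intro w hw p q
    rw [← intervalIntegral.integral_add (Continuous.intervalIntegrable (by fun_prop) _ _)
      (Continuous.intervalIntegrable (by fun_prop) _ _)]
    simp [mul_add]
  have hsmul : ∀ (w : ℝ → ℝ) (c : ℝ) (p : ℝ[X]), ∫ x in l..r, w x * (c • p).eval x =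
      c * ∫ x in l..r, w x * p.eval x := by
    intro w c p
    rw [← intervalIntegral.integral_const_mul]
    congr 1; ext x; simp; ring
  let D : (w : ℝ → ℝ) → Continuous w → Module.Dual ℝ W := fun w hw =>
    { toFun := fun φ => ∫ x in l..r, w x * (φ : ℝ[X]).eval x
      map_add' := fun p q => hadd w hw p q
      map_smul' := fun c p => hsmul w c p }
  let Φ : W →ₗ[ℝ] Module.Dual ℝ W :=
    { toFun := fun p => D (fun x => (p : ℝ[X]).eval x) (by fun_prop)
      map_add' := fun p q => by
        ext φ
        have := hadd (fun x => (φ : ℝ[X]).eval x) (by fun_prop) p q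
        simpa [D, mul_comm] using this
      map_smul' := fun c p => by
        ext φ
        have := hsmul (fun x => (φ : ℝ[X]).eval x) c p
        simpa [D, mul_comm] using this }
  have hinj : Function.Injective Φ := by
    rw [injective_iff_map_eq_zero]
    intro p hp
    by_contra hne
    have h0 : ∫ x in l..r, (p : ℝ[X]).eval x * (p : ℝ[X]).eval x = 0 := by
      simpa [Φ, D] using congrArg (fun f => f p) hp
    have := intervalIntegral_sq_pos hlr (p := (p : ℝ[X])) (by simpa using hne)
    simp only [sq] at this
    exact this.ne' h0
  have : FiniteDimensional ℝ W := Module.Finite.equiv (degreeLTEquiv ℝ (k + 1)).symm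
  have hsurj : Function.Surjective Φ :=
    (LinearMap.injective_iff_surjective_of_finrank_eq_finrank
      (Subspace.dual_finrank_eq).symm).1 hinj
  obtain ⟨P, hP⟩ := hsurj (D g hg)
  refine ⟨P, (hmem _).1 P.2, fun φ hφ => ?_⟩
  have h0 : ∫ x in l..r, (P : ℝ[X]).eval x * φ.eval x = ∫ x in l..r, g x * φ.eval x :=
    congrArg (fun f => f ⟨φ, (hmem φ).2 hφ⟩) hP
  simp only [sub_mul]
  rw [intervalIntegral.integral_sub (Continuous.intervalIntegrable (by fun_prop) _ _)
      (Continuous.intervalIntegrable (by fun_prop) _ _), h0, sub_self]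

/-! ### Estimates on one cell -/

theorem abs_integral_le_of_abs_le {l r c : ℝ} (hlr : l ≤ r) {f : ℝ → ℝ}
    (hf : ∀ x ∈ Icc l r, |f x| ≤ c) : |∫ x in l..r, f x| ≤ c * (r - l) := by
  have := intervalIntegral.norm_integral_le_of_norm_le_const (a := l) (b := r) (f := f) (C := c)
    (fun x hx => hf x (by rw [uIoc_of_le hlr] at hx; exact Ioc_subset_Icc_self hx))
  rwa [abs_of_nonneg (sub_nonneg.2 hlr)] at this

theorem natDegree_sub_le_of_both_le {p q : ℝ[X]} {k : ℕ} (hp : p.natDegree ≤ k)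
    (hq : q.natDegree ≤ k) : (p - q).natDegree ≤ k :=
  (natDegree_sub_le p q).trans (max_le hp hq)

/-- `P` is the `L²(l, r)` projection of `g` on the polynomials of degree at most `k`. -/
def IsL2Projection (k : ℕ) (l r : ℝ) (g : ℝ → ℝ) (P : ℝ[X]) : Prop :=
  P.natDegree ≤ k ∧ ∀ φ : ℝ[X], φ.natDegree ≤ k → ∫ x in l..r, (P.eval x - g x) * φ.eval x = 0

theorem IsL2Projection.integral_sq_le {k : ℕ} {l r : ℝ} (hlr : l ≤ r) {g : ℝ → ℝ}
    (hg : Continuous g) {P : ℝ[X]} (hP : IsL2Projection k l r g P) {w : ℝ[X]}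
    (hw : w.natDegree ≤ k) :
    ∫ x in l..r, (P - w).eval x ^ 2 ≤ ∫ x in l..r, (g x - w.eval x) ^ 2 := by
  have h0 := hP.2 (P - w) (natDegree_sub_le_of_both_le hP.1 hw)
  have h1 : ∫ x in l..r, (g x - w.eval x) ^ 2 =
      (∫ x in l..r, (P - w).eval x ^ 2) + (∫ x in l..r, (P.eval x - g x) ^ 2)
        - 2 * ∫ x in l..r, (P.eval x - g x) * (P - w).eval x := by
    rw [← intervalIntegral.integral_const_mul, ← intervalIntegral.integral_add
      (Continuous.intervalIntegrable (by fun_prop) _ _)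
      (Continuous.intervalIntegrable (by fun_prop) _ _), ← intervalIntegral.integral_sub
      (Continuous.intervalIntegrable (by fun_prop) _ _)
      (Continuous.intervalIntegrable (by fun_prop) _ _)]
    congr 1
    ext x
    simp only [eval_sub]
    ring
  have h2 : 0 ≤ ∫ x in l..r, (P.eval x - g x) ^ 2 :=
    intervalIntegral.integral_nonneg hlr fun x _ => sq_nonneg _
  rw [h0] at h1
  linarith

/-- The `L²` projection is quasi-optimal in the maximum norm. -/
theorem exists_projection_bound (k : ℕ) :
    ∃ K, 0 ≤ K ∧ ∀ l r δ : ℝ, l < r → ∀ g : ℝ → ℝ, Continuous g → ∀ P Q : ℝ[X],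
      IsL2Projection k l r g P → Q.natDegree ≤ k → (∀ x ∈ Icc l r, |g x - Q.eval x| ≤ δ) →
      ∀ x ∈ Icc l r, |P.eval x - g x| ≤ K * δ := by
  obtain ⟨K, hK, h⟩ := exists_inverse_bound k
  refine ⟨√K + 1, by positivity, fun l r δ hlr g hg P Q hP hQ hδ x hx => ?_⟩
  have hd : 0 < r - l := sub_pos.2 hlr
  have hδ0 : 0 ≤ δ := (abs_nonneg _).trans (hδ x hx)
  have h1 := (h l r hlr (P - Q) (natDegree_sub_le_of_both_le hP.1 hQ) x hx).1
  have h2 := hP.integral_sq_le hlr.le hg hQ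
  have h3 : ∫ x in l..r, (g x - Q.eval x) ^ 2 ≤ δ ^ 2 * (r - l) := by
    refine (le_abs_self _).trans (abs_integral_le_of_abs_le hlr.le fun y hy => ?_)
    rw [abs_of_nonneg (sq_nonneg _), ← sq_abs]
    gcongr
    exact hδ y hy
  have h4 : (P - Q).eval x ^ 2 ≤ K * δ ^ 2 := by
    have : (r - l) * (P - Q).eval x ^ 2 ≤ (r - l) * (K * δ ^ 2) := by
      calc _ ≤ K * (δ ^ 2 * (r - l)) := h1.trans (by gcongr; exact h2.trans h3)
        _ = _ := by ring
    exact le_of_mul_le_mul_left this hd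
  have h5 : |(P - Q).eval x| ≤ √K * δ := by
    apply abs_le_of_sq_le_sq _ (by positivity)
    rw [mul_pow, Real.sq_sqrt hK.le]
    exact h4
  rw [eval_sub] at h5
  have h6 := hδ x hx
  rw [abs_le] at *
  constructor <;> linarith [h5.1, h5.2, h6.1, h6.2]

theorem natDegree_derivative_le_of_le {p : ℝ[X]} {k : ℕ} (hp : p.natDegree ≤ k) :
    (derivative p).natDegree ≤ k :=
  (natDegree_derivative_le p).trans ((Nat.sub_le _ _).trans hp)

/-- The consistency term of the energy estimate on one cell, with `ξ = P - w` and `η = P - U`. -/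
def consistency (U : ℝ → ℝ) (P w : ℝ[X]) (x : ℝ) : ℝ :=
  (U x * (P.eval x - U x) - (P - w).eval x * (P.eval x - U x) + (P.eval x - U x) ^ 2 / 2)
    * (derivative (P - w)).eval x

/-- The derivative of `ξ` costs a factor `1/h`. In the term linear in `η` this is recovered by
orthogonality: `U` may be replaced by `U - U l = O(h)`. The other two terms are already of second
order in `ξ` and `η`. The bound `X` stands for the size of `ξ` and of `h ξ'`, supplied later by
inverse inequalities. -/
theorem IsL2Projection.abs_integral_consistency_le {k : ℕ} {l r h D L X : ℝ} (hlr : l ≤ r)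
    (hrh : r - l ≤ h) (h0 : 0 < h) (h1 : h ≤ 1) {U U' : ℝ → ℝ} (hU : ∀ x, HasDerivAt U (U' x) x)
    (hL : ∀ x ∈ Icc l r, |U' x| ≤ L) {P w : ℝ[X]} (hP : IsL2Projection k l r U P)
    (hw : w.natDegree ≤ k) (hD : ∀ x ∈ Icc l r, |P.eval x - U x| ≤ D * h ^ (k + 1))
    (hX : ∀ x ∈ Icc l r, |(P - w).eval x| ≤ X)
    (hX' : ∀ x ∈ Icc l r, h * |(derivative (P - w)).eval x| ≤ X) :
    |∫ x in l..r, consistency U P w x| ≤ (L * D + D + D ^ 2) * h * (h ^ (2 * k + 1) + X ^ 2) := by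
  have hUc : Continuous U := continuous_iff_continuousAt.2 fun x => (hU x).continuousAt
  have hl : l ∈ Icc l r := left_mem_Icc.2 hlr
  have hL0 : 0 ≤ L := (abs_nonneg _).trans (hL l hl)
  have hX0 : 0 ≤ X := (abs_nonneg _).trans (hX l hl)
  have hD0 : 0 ≤ D := by
    have := (abs_nonneg _).trans (hD l hl)
    exact nonneg_of_mul_nonneg_left this (by positivity)
  have horth := hP.2 (derivative (P - w))
    (natDegree_derivative_le_of_le (natDegree_sub_le_of_both_le hP.1 hw))
  have hUlip : ∀ x ∈ Icc l r, |U x - U l| ≤ L * h := fun x hx => by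
    have := (convex_Icc l r).norm_image_sub_le_of_norm_hasDerivWithin_le
      (fun y _ => (hU y).hasDerivWithinAt) (fun y hy => hL y hy) hl hx
    refine this.trans ?_
    gcongr
    rw [Real.norm_eq_abs, abs_of_nonneg (sub_nonneg.2 hx.1)]
    linarith [hx.2]
  have hsplit : ∫ x in l..r, consistency U P w x = ∫ x in l..r,
      ((U x - U l) * (P.eval x - U x) - (P - w).eval x * (P.eval x - U x)
        + (P.eval x - U x) ^ 2 / 2) * (derivative (P - w)).eval x := by
    rw [← sub_eq_zero, ← intervalIntegral.integral_sub
      (Continuous.intervalIntegrable (by unfold consistency; fun_prop) _ _)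
      (Continuous.intervalIntegrable (by fun_prop) _ _)]
    rw [← mul_zero (U l), ← horth, ← intervalIntegral.integral_const_mul]
    congr 1
    ext x
    simp only [consistency]
    ring
  rw [hsplit]
  set s := h ^ k with hs
  have hs0 : 0 ≤ s := by positivity
  have hs1 : s ≤ 1 := pow_le_one₀ h0.le h1
  have hpow : h ^ (k + 1) = h * s := by rw [hs]; ring
  have hpow2 : h ^ (2 * k + 1) = h * s ^ 2 := by rw [hs]; ring
  rw [hpow] at hD
  rw [hpow2]
  have hpt : ∀ x ∈ Icc l r, |((U x - U l) * (P.eval x - U x) - (P - w).eval x * (P.eval x - U x)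
        + (P.eval x - U x) ^ 2 / 2) * (derivative (P - w)).eval x| ≤
      (L * h * (D * (h * s)) + X * (D * (h * s)) + (D * (h * s)) ^ 2 / 2) * (X / h) := by
    intro x hx
    rw [abs_mul]
    have hd : |(derivative (P - w)).eval x| ≤ X / h := by
      rw [le_div_iff₀ h0, mul_comm]; exact hX' x hx
    have e1 := hD x hx
    have e2 := hX x hx
    have e3 := hUlip x hx
    refine mul_le_mul ?_ hd (abs_nonneg _) (by positivity)
    refine (abs_add_le _ _).trans (add_le_add ((abs_sub _ _).trans (add_le_add ?_ ?_)) ?_)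
    · rw [abs_mul]; gcongr
    · rw [abs_mul]; gcongr
    · rw [abs_div, abs_pow, abs_two]; gcongr
  refine (abs_integral_le_of_abs_le hlr hpt).trans ?_
  calc _ ≤ (L * h * (D * (h * s)) + X * (D * (h * s)) + (D * (h * s)) ^ 2 / 2) * (X / h) * h := by
        gcongr
    _ = L * D * h * (h * s * X) + D * h * (s * X ^ 2) + D ^ 2 * h * (h * s ^ 2 * X / 2) := by
        field_simp
    _ ≤ L * D * h * (h * s ^ 2 + X ^ 2) + D * h * (h * s ^ 2 + X ^ 2)
        + D ^ 2 * h * (h * s ^ 2 + X ^ 2) := by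
        have hh : h ^ 2 ≤ h := by nlinarith
        have hss : s ^ 2 ≤ 1 := pow_le_one₀ hs0 hs1
        gcongr
        · nlinarith [sq_nonneg (h * s - X), mul_le_mul_of_nonneg_right hh (sq_nonneg s),
            sq_nonneg X, sq_nonneg (h * s)]
        · nlinarith [mul_le_mul_of_nonneg_right hs1 (sq_nonneg X),
            mul_nonneg h0.le (sq_nonneg s)]
        · have : (h * s ^ 2) ^ 2 ≤ h * s ^ 2 := by
            have a1 : h * s ^ 2 ≤ 1 := by nlinarith
            nlinarith [mul_nonneg h0.le (sq_nonneg s)]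
          nlinarith [sq_nonneg (h * s ^ 2 - X), sq_nonneg X]
    _ = _ := by ring

/-- Exchanges the error for the admissible test function `P - w`. As `η` is orthogonal to
polynomials, `wt` may be traded for any approximation `q` of `Ut`; order `h ^ k` suffices for `q`,
since `η` contributes `h ^ (k + 1)`. -/
theorem IsL2Projection.integral_mul_error_le {k : ℕ} {l r h D B : ℝ} (hlr : l ≤ r)
    (hrh : r - l ≤ h) (h0 : 0 < h) (hD0 : 0 ≤ D) (hB0 : 0 ≤ B) {U Ut : ℝ → ℝ} (hU : Continuous U)
    (hUt : Continuous Ut) {P w wt q : ℝ[X]} (hP : IsL2Projection k l r U P)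
    (hwt : wt.natDegree ≤ k) (hq : q.natDegree ≤ k)
    (hD : ∀ x ∈ Icc l r, |P.eval x - U x| ≤ D * h ^ (k + 1))
    (hB : ∀ x ∈ Icc l r, |Ut x - q.eval x| ≤ B * h ^ k) :
    ∫ x in l..r, (U x - w.eval x) * (Ut x - wt.eval x) ≤
      (∫ x in l..r, (Ut x - wt.eval x) * (P - w).eval x) + B * D * h * h ^ (2 * k + 1) := by
  have horth := hP.2 (q - wt) (natDegree_sub_le_of_both_le hq hwt)
  have h1 : (∫ x in l..r, (U x - w.eval x) * (Ut x - wt.eval x)) =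
      (∫ x in l..r, (Ut x - wt.eval x) * (P - w).eval x)
      - (∫ x in l..r, (P.eval x - U x) * (q - wt).eval x)
      - ∫ x in l..r, (P.eval x - U x) * (Ut x - q.eval x) := by
    rw [← intervalIntegral.integral_sub (Continuous.intervalIntegrable (by fun_prop) _ _)
      (Continuous.intervalIntegrable (by fun_prop) _ _), ← intervalIntegral.integral_sub
      (Continuous.intervalIntegrable (by fun_prop) _ _)
      (Continuous.intervalIntegrable (by fun_prop) _ _)]
    congr 1
    ext x
    simp only [eval_sub]
    ring
  have h2 : |∫ x in l..r, (P.eval x - U x) * (Ut x - q.eval x)| ≤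
      (D * h ^ (k + 1) * (B * h ^ k)) * (r - l) := by
    refine abs_integral_le_of_abs_le hlr fun x hx => ?_
    have e1 := hD x hx
    have e2 := hB x hx
    rw [abs_mul]
    gcongr
  have h3 : (D * h ^ (k + 1) * (B * h ^ k)) * (r - l) ≤ B * D * h * h ^ (2 * k + 1) := by
    calc _ ≤ (D * h ^ (k + 1) * (B * h ^ k)) * h := by gcongr
      _ = _ := by ring
  rw [horth] at h1
  linarith [(abs_le.1 h2).1]

/-! ### The interface terms -/

/-- Dissipation at an interface. Here `p`, `q` are the one-sided values of `ξ`, `m`, `n` those of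
`η`, and `u + m - p`, `u + n - q` those of the discrete solution. -/
theorem interface_estimate {u p q m n α ε : ℝ} (hm : |m| ≤ ε) (hn : |n| ≤ ε)
    (hp : |u + m - p| ≤ α) (hq : |u + n - q| ≤ α) :
    (flux u - (flux (u + m - p) + flux (u + n - q) - α * ((u + m - p) - (u + n - q))) / 2) * (p - q)
      + u * (q ^ 2 - p ^ 2) / 2 - (q ^ 3 - p ^ 3) / 6 ≤
      4 * (ε * (p ^ 2 + q ^ 2) + α * ε ^ 2 + ε ^ 2 * (|p| + |q|)) := by
  have hε : 0 ≤ ε := (abs_nonneg _).trans hm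
  have hα : 0 ≤ α := (abs_nonneg _).trans hp
  set s := p - q with hs
  have hsabs : |s| ≤ |p| + |q| := abs_sub _ _
  have key : (flux u - (flux (u + m - p) + flux (u + n - q)
      - α * ((u + m - p) - (u + n - q))) / 2) * s + u * (q ^ 2 - p ^ 2) / 2 - (q ^ 3 - p ^ 3) / 6 =
      -(u * (m + n) * s) / 2 - s ^ 3 / 12 + (m * p + n * q) * s / 2 - (m ^ 2 + n ^ 2) * s / 4
        + α * (m - n) * s / 2 - α * s ^ 2 / 2 := by
    simp only [flux, hs]; ring
  rw [key]
  have hs2 : s ^ 2 ≤ 2 * (p ^ 2 + q ^ 2) := by rw [hs]; nlinarith [sq_nonneg (p + q)]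
  -- Up to `m - n`, the number `-s` is the jump of the discrete solution, whose one-sided values are
  -- at most `α`.
  have hcube : -s ^ 3 ≤ (2 * α + 2 * ε) * s ^ 2 := by
    have : -s ≤ 2 * α + 2 * ε := by
      rw [abs_le] at *
      simp only [hs]; linarith [hp.1, hp.2, hq.1, hq.2, hm.1, hm.2, hn.1, hn.2]
    calc -s ^ 3 = (-s) * s ^ 2 := by ring
      _ ≤ _ := by gcongr
  have hmn : |m + n| ≤ 2 * ε := (abs_add_le _ _).trans (by linarith)
  have hmn' : |m - n| ≤ 2 * ε := (abs_sub _ _).trans (by linarith)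
  -- The exact value is the average of the two discrete ones up to `m, n, p, q`. Measuring `u` by
  -- `α` lets the viscosity control the first term of `key` even where `α` is close to 0.
  have hu : |u| ≤ α + ε + (|p| + |q|) / 2 := by
    have hpa := abs_le.1 (le_refl |p|)
    have hqa := abs_le.1 (le_refl |q|)
    rw [abs_le] at hp hq hm hn ⊢
    constructor <;> linarith [hp.1, hp.2, hq.1, hq.2, hm.1, hm.2, hn.1, hn.2, hpa.1, hpa.2,
      hqa.1, hqa.2]
  have t1 : -(u * (m + n) * s) ≤ (α + ε + (|p| + |q|) / 2) * (2 * ε) * |s| := by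
    refine (neg_le_abs _).trans ?_
    rw [abs_mul, abs_mul]
    gcongr
  have t2 : (m * p + n * q) * s ≤ ε * (|p| + |q|) * |s| := by
    refine (le_abs_self _).trans ?_
    rw [abs_mul]
    gcongr
    refine (abs_add_le _ _).trans ?_
    rw [abs_mul, abs_mul, mul_add]
    gcongr
  have t3 : -((m ^ 2 + n ^ 2) * s) ≤ 2 * ε ^ 2 * |s| := by
    refine (neg_le_abs _).trans ?_
    rw [abs_mul, abs_of_nonneg (by positivity), ← sq_abs m, ← sq_abs n]
    have : |m| ^ 2 + |n| ^ 2 ≤ 2 * ε ^ 2 := by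
      have a1 : |m| ^ 2 ≤ ε ^ 2 := by gcongr
      have a2 : |n| ^ 2 ≤ ε ^ 2 := by gcongr
      linarith
    gcongr
  have t4 : α * (m - n) * s ≤ α * (2 * ε) * |s| := by
    refine (le_abs_self _).trans ?_
    rw [abs_mul, abs_mul, abs_of_nonneg hα]
    gcongr
  -- The dissipation `α * s ^ 2 / 2` is spent exactly: `α * s ^ 2 / 6` on the cubic term and `α * s
  -- ^ 2 / 3` here, on the sum of the `α`-parts of `t1` and `t4`.
  have t5 : 2 * α * ε * |s| ≤ α * (s ^ 2 / 3 + 3 * ε ^ 2) := by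
    have : 2 * ε * |s| ≤ s ^ 2 / 3 + 3 * ε ^ 2 := by
      rw [← sq_abs s]; nlinarith [sq_nonneg (|s| - 3 * ε)]
    calc _ = α * (2 * ε * |s|) := by ring
      _ ≤ _ := by gcongr
  have t6 : ε * ((|p| + |q|) * |s|) ≤ ε * (2 * (p ^ 2 + q ^ 2)) := by
    refine mul_le_mul_of_nonneg_left ?_ hε
    rw [← sq_abs p, ← sq_abs q]
    nlinarith [sq_nonneg (|p| - |q|), abs_nonneg p, abs_nonneg q]
  have t7 : ε ^ 2 * |s| ≤ ε ^ 2 * (|p| + |q|) := by gcongr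
  have t8 : ε * s ^ 2 ≤ ε * (2 * (p ^ 2 + q ^ 2)) := by gcongr
  have t9 : 0 ≤ ε * (p ^ 2 + q ^ 2) := by positivity
  have t10 : 0 ≤ α * ε ^ 2 := by positivity
  have t11 : 0 ≤ ε ^ 2 * (|p| + |q|) := by positivity
  linarith

theorem sum_fin_succ_sub_castSucc {n : ℕ} (f : Fin (n + 1) → ℝ) :
    ∑ j : Fin n, (f j.succ - f j.castSucc) = f (Fin.last n) - f 0 := by
  induction n with
  | zero => simp
  | succ n ih =>
    rw [Fin.sum_univ_castSucc]
    have := ih (fun i => f i.castSucc)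
    simp only [← Fin.succ_castSucc] at this
    rw [this]
    simp

theorem val_finRotate {n : ℕ} (j : Fin n) :
    ((j : ℕ) + 1 < n ∧ ((finRotate n j : Fin n) : ℕ) = j + 1) ∨
      ((j : ℕ) + 1 = n ∧ ((finRotate n j : Fin n) : ℕ) = 0) := by
  cases n with
  | zero => exact j.elim0
  | succ n =>
    rcases eq_or_ne j (Fin.last n) with rfl | hj
    · right; simp
    · left
      have h1 : (j : ℕ) < n := Fin.val_lt_last hj
      exact ⟨by omega, coe_finRotate_of_ne_last hj⟩

theorem deriv_flux (w : ℝ) : deriv flux w = w := by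
  have : HasDerivAt flux w w := by
    have := ((hasDerivAt_id w).pow 2).div_const 2
    refine this.congr_deriv ?_
    simp
  exact this.deriv

/-! ### Geometry of the mesh, cyclic indexing and the viscosity -/

namespace Mesh

variable {a b : ℝ} (M : Mesh a b)

theorem left_lt_right (j : Fin M.N) : M.left j < M.right j :=
  M.strictMono (by simp)

theorem size_pos (j : Fin M.N) : 0 < M.size j := sub_pos.2 (M.left_lt_right j)

theorem size_le_h (j : Fin M.N) : M.size j ≤ M.h :=
  le_ciSup (f := M.size) (Set.finite_range _).bddAbove j

theorem N_pos (hab : a < b) : 0 < M.N := by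
  rcases M with ⟨N, node, h0, h1, hm⟩
  cases N with
  | zero => exact absurd (h0.symm.trans h1) hab.ne
  | succ n => exact Nat.succ_pos n

theorem h_pos (hab : a < b) : 0 < M.h :=
  (M.size_pos ⟨0, M.N_pos hab⟩).trans_le (M.size_le_h _)

theorem sum_size : ∑ j, M.size j = b - a := by
  have := sum_fin_succ_sub_castSucc M.node
  rw [M.node_zero, M.node_last] at this
  exact this

/-- Regularity limits the number of cells to `O(1/h)`, so that bounds summed over cells or
interfaces lose at most one power of `h`. -/
theorem card_mul_h_le {ρ : ℝ} (hρ : 0 < ρ) (hM : M.IsRegular ρ) : M.N * M.h ≤ (b - a) / ρ := by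
  rw [le_div_iff₀ hρ, ← M.sum_size]
  calc M.N * M.h * ρ = ∑ _j : Fin M.N, ρ * M.h := by simp; ring
    _ ≤ _ := Finset.sum_le_sum fun j _ => hM j

theorem cell_subset (j : Fin M.N) : Icc (M.left j) (M.right j) ⊆ Icc a b := by
  apply Icc_subset_Icc
  · exact M.node_zero.symm.le.trans (M.strictMono.monotone (Fin.zero_le _))
  · exact (M.strictMono.monotone (Fin.le_last _)).trans M.node_last.le

theorem sum_integral_cells {f : ℝ → ℝ} (hf : Continuous f) :
    ∑ j, ∫ x in M.left j..M.right j, f x = ∫ x in a..b, f x := by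
  have h1 := sum_fin_succ_sub_castSucc fun i => ∫ x in a..M.node i, f x
  simp only [M.node_zero, M.node_last, intervalIntegral.integral_same, sub_zero] at h1
  rw [← h1]
  refine Finset.sum_congr rfl fun j _ => ?_
  rw [intervalIntegral.integral_interval_sub_left (hf.intervalIntegrable _ _)
    (hf.intervalIntegrable _ _)]
  rfl

/-- A function with equal values at `a` and `b` is single-valued at the interfaces. -/
theorem apply_left_next {g : ℝ → ℝ} (hg : g a = g b) (j : Fin M.N) :
    g (M.left (M.next j)) = g (M.right j) := by
  unfold left right next
  rcases val_finRotate j with ⟨_, h⟩ | ⟨h', h⟩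
  · have e1 : (finRotate M.N j).castSucc = j.succ := Fin.ext h
    rw [e1]
  · have e1 : (finRotate M.N j).castSucc = 0 := Fin.ext h
    have e2 : j.succ = Fin.last M.N := by ext; simp [h']
    rw [e1, e2, M.node_zero, M.node_last, hg]

theorem sum_next (f : Fin M.N → ℝ) : ∑ j, f (M.next j) = ∑ j, f j :=
  Equiv.sum_comp (finRotate M.N) f

theorem prev_next (j : Fin M.N) : M.prev (M.next j) = j :=
  (finRotate M.N).symm_apply_apply j

theorem abs_eval_le_alpha (w : M.Broken) (j : Fin M.N) {x : ℝ}
    (hx : x ∈ Icc (M.left j) (M.right j)) : |(w j).eval x| ≤ M.alpha w := by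
  have hbdd : ∀ i, ∃ c, ∀ y ∈ Icc (M.left i) (M.right i), |(w i).eval y| ≤ c := fun i =>
    (isCompact_Icc.exists_bound_of_continuousOn (w i).continuous.continuousOn)
  choose c hc using hbdd
  obtain ⟨C, hC⟩ := (Set.finite_range c).bddAbove
  refine le_csSup ⟨C, ?_⟩ ⟨j, x, hx, by rw [deriv_flux]⟩
  rintro _ ⟨i, y, hy, rfl⟩
  rw [deriv_flux]
  exact (hc i y hy).trans (hC (mem_range_self i))

theorem alpha_le (w : M.Broken) {c : ℝ} (hN : 0 < M.N)
    (hc : ∀ j, ∀ x ∈ Icc (M.left j) (M.right j), |(w j).eval x| ≤ c) : M.alpha w ≤ c := by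
  refine csSup_le ⟨_, ⟨0, hN⟩, _, left_mem_Icc.2 (M.left_lt_right _).le, rfl⟩ ?_
  rintro _ ⟨i, y, hy, rfl⟩
  rw [deriv_flux]
  exact hc i y hy

/-! ### The nonlocal term -/

variable {M}

/-- Within a cell `V - z` varies by at most the L¹ error there, and it is continuous across interior
interfaces. Adding these variations from the first left end point, where it equals `c`, gives one L¹
norm up to the end of the cell `j`, and a second one bounds the way back to `x`. -/
theorem abs_antiderivative_error_le_of_base (hN : 0 < M.N) {U V : ℝ → ℝ} (hU : Continuous U)
    (hV : ∀ x, HasDerivAt V (U x) x) {w z : M.Broken}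
    (hz : ∀ j, ∀ x ∈ Icc (M.left j) (M.right j),
      (z j).eval x = (z j).eval (M.right j) - ∫ y in x..M.right j, (w j).eval y)
    (hzc : ∀ i j : Fin M.N, (j : ℕ) = i + 1 → (z i).eval (M.right i) = (z j).eval (M.left j)) :
    ∃ c, ∀ j, ∀ x ∈ Icc (M.left j) (M.right j), |V x - (z j).eval x - c| ≤
      2 * ∑ i, ∫ y in M.left i..M.right i, |U y - (w i).eval y| := by
  set D : Fin M.N → ℝ := fun i => ∫ y in M.left i..M.right i, |U y - (w i).eval y| with hD
  have hDn : ∀ i, 0 ≤ D i := fun i =>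
    intervalIntegral.integral_nonneg (M.left_lt_right i).le fun _ _ => abs_nonneg _
  have hDS : ∀ i, D i ≤ ∑ i, D i := fun i =>
    Finset.single_le_sum (fun j _ => hDn j) (Finset.mem_univ i)
  have hcell : ∀ j, ∀ x ∈ Icc (M.left j) (M.right j),
      |V (M.right j) - (z j).eval (M.right j) - (V x - (z j).eval x)| ≤ D j := by
    intro j x hx
    have h1 : ∫ y in x..M.right j, U y = V (M.right j) - V x :=
      intervalIntegral.integral_eq_sub_of_hasDerivAt (fun y _ => hV y) (hU.intervalIntegrable _ _)
    have h2 : V (M.right j) - (z j).eval (M.right j) - (V x - (z j).eval x) =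
        ∫ y in x..M.right j, (U y - (w j).eval y) := by
      rw [intervalIntegral.integral_sub (hU.intervalIntegrable _ _)
        (Continuous.intervalIntegrable (by fun_prop) _ _), h1, hz j x hx]
      ring
    rw [h2]
    refine (intervalIntegral.abs_integral_le_integral_abs hx.2).trans ?_
    exact intervalIntegral.integral_mono_interval hx.1 hx.2 le_rfl
      (Filter.Eventually.of_forall fun _ => abs_nonneg _)
      (Continuous.intervalIntegrable (by fun_prop) _ _)
  set j₀ : Fin M.N := ⟨0, hN⟩
  set c := V (M.left j₀) - (z j₀).eval (M.left j₀) with hc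
  -- Extension by zero to all natural numbers, so that the chain along the cells is an induction
  -- with partial sums over `Finset.range`.
  set D' : ℕ → ℝ := fun n => if h : n < M.N then D ⟨n, h⟩ else 0 with hD'
  have hD'n : ∀ n, 0 ≤ D' n := fun n => by
    simp only [hD']; split
    · exact hDn _
    · exact le_rfl
  have hDv : ∀ n (h : n < M.N), D' n = D ⟨n, h⟩ := fun n h => by simp [hD', h]
  have hsum : ∑ i ∈ Finset.range M.N, D' i = ∑ i, D i := by
    rw [Finset.sum_range]
    exact Finset.sum_congr rfl fun i _ => hDv i i.2
  have chain : ∀ n (h : n < M.N), |V (M.right ⟨n, h⟩) - (z ⟨n, h⟩).eval (M.right ⟨n, h⟩) - c| ≤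
      ∑ i ∈ Finset.range (n + 1), D' i := by
    intro n
    induction n with
    | zero =>
      intro h
      simp only [zero_add, Finset.sum_range_one, hDv 0 h]
      exact hcell ⟨0, h⟩ _ (left_mem_Icc.2 (M.left_lt_right _).le)
    | succ n ih =>
      intro h
      have hn : n < M.N := by omega
      have h1 := ih hn
      have h2 := hcell ⟨n + 1, h⟩ _ (left_mem_Icc.2 (M.left_lt_right _).le)
      have h3 := hzc ⟨n, hn⟩ ⟨n + 1, h⟩ rfl
      have h4 : M.left ⟨n + 1, h⟩ = M.right ⟨n, hn⟩ := rfl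
      rw [← h3, h4] at h2
      rw [Finset.sum_range_succ, hDv _ h]
      rw [abs_le] at *
      constructor <;> linarith [h1.1, h1.2, h2.1, h2.2]
  refine ⟨c, fun j x hx => ?_⟩
  have h1 := chain j j.2
  have h2 : ∑ i ∈ Finset.range ((j : ℕ) + 1), D' i ≤ ∑ i, D i := by
    rw [← hsum]
    refine Finset.sum_le_sum_of_subset_of_nonneg ?_ fun i _ _ => hD'n i
    intro i hi
    have := j.2
    simp only [Finset.mem_range] at *
    omega
  have h3 := hcell j x hx
  have h4 := hDS j
  simp only [Fin.eta] at h1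
  rw [abs_le] at *
  constructor <;> linarith [h1.1, h1.2, h3.1, h3.2]

/-- Cauchy–Schwarz on the broken space: the integral of `(|e| - c) ^ 2` is nonnegative, taken at the
minimising `c`, the mean of `|e|`. -/
theorem sq_sum_integral_abs_le (hab : a < b) {U : ℝ → ℝ} (hU : Continuous U) (w : M.Broken) :
    (∑ i, ∫ y in M.left i..M.right i, |U y - (w i).eval y|) ^ 2 ≤
      (b - a) * ∑ i, ∫ y in M.left i..M.right i, (U y - (w i).eval y) ^ 2 := by
  set S := ∑ i, ∫ y in M.left i..M.right i, |U y - (w i).eval y| with hS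
  set Q := ∑ i, ∫ y in M.left i..M.right i, (U y - (w i).eval y) ^ 2 with hQ
  have hd : 0 < b - a := sub_pos.2 hab
  have key : ∀ c : ℝ, 0 ≤ Q - 2 * c * S + c ^ 2 * (b - a) := by
    intro c
    have : ∑ i, ∫ y in M.left i..M.right i, (|U y - (w i).eval y| - c) ^ 2 =
        Q - 2 * c * S + c ^ 2 * (b - a) := by
      rw [hQ, hS, ← M.sum_size, Finset.mul_sum, Finset.mul_sum, ← Finset.sum_sub_distrib,
        ← Finset.sum_add_distrib]
      refine Finset.sum_congr rfl fun i _ => ?_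
      have : c ^ 2 * M.size i = ∫ y in M.left i..M.right i, c ^ 2 := by
        simp [size, mul_comm]
      rw [this, ← intervalIntegral.integral_const_mul, ← intervalIntegral.integral_sub
        (Continuous.intervalIntegrable (by fun_prop) _ _)
        (Continuous.intervalIntegrable (by fun_prop) _ _), ← intervalIntegral.integral_add
        (Continuous.intervalIntegrable (by fun_prop) _ _)
        (Continuous.intervalIntegrable (by fun_prop) _ _)]
      congr 1
      ext y
      rw [← sq_abs (U y - _)]
      ring
    rw [← this]
    exact Finset.sum_nonneg fun i _ =>
      intervalIntegral.integral_nonneg (M.left_lt_right i).le fun _ _ => sq_nonneg _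
  have h1 := key (S / (b - a))
  have h2 : Q - 2 * (S / (b - a)) * S + (S / (b - a)) ^ 2 * (b - a) = Q - S ^ 2 / (b - a) := by
    field_simp; ring
  rw [h2, sub_nonneg, div_le_iff₀ hd] at h1
  linarith

theorem sq_antiderivative_error_le (hab : a < b) {U V : ℝ → ℝ} (hU : Continuous U)
    (hV : ∀ x, HasDerivAt V (U x) x) (hVm : ∫ x in a..b, V x = 0) {w z : M.Broken}
    (hz : ∀ j, ∀ x ∈ Icc (M.left j) (M.right j),
      (z j).eval x = (z j).eval (M.right j) - ∫ y in x..M.right j, (w j).eval y)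
    (hzc : ∀ i j : Fin M.N, (j : ℕ) = i + 1 → (z i).eval (M.right i) = (z j).eval (M.left j))
    (hzm : ∑ j, ∫ x in M.left j..M.right j, (z j).eval x = 0) (j : Fin M.N) {x : ℝ}
    (hx : x ∈ Icc (M.left j) (M.right j)) :
    (V x - (z j).eval x) ^ 2 ≤
      16 * ((b - a) * ∑ i, ∫ y in M.left i..M.right i, (U y - (w i).eval y) ^ 2) := by
  obtain ⟨c, hc⟩ := abs_antiderivative_error_le_of_base (M.N_pos hab) hU hV hz hzc
  have hS2 := sq_sum_integral_abs_le hab hU w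
  set S := ∑ i, ∫ y in M.left i..M.right i, |U y - (w i).eval y|
  have hVc : Continuous V := continuous_iff_continuousAt.2 fun x => (hV x).continuousAt
  have hd : 0 < b - a := sub_pos.2 hab
  -- Both `V` and `z` have zero mean, so the mean of `V - z - c` is `-c`; this bounds the unknown
  -- constant by `2 * S` and the whole difference by `4 * S`.
  have hmean : ∑ j, ∫ x in M.left j..M.right j, (V x - (z j).eval x - c) = -(c * (b - a)) := by
    have h1 : ∀ j, ∫ x in M.left j..M.right j, (V x - (z j).eval x - c) =
        (∫ x in M.left j..M.right j, V x) - (∫ x in M.left j..M.right j, (z j).eval x)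
          - c * M.size j := by
      intro j
      rw [intervalIntegral.integral_sub (Continuous.intervalIntegrable (by fun_prop) _ _)
        (Continuous.intervalIntegrable (by fun_prop) _ _), intervalIntegral.integral_sub
        (Continuous.intervalIntegrable (by fun_prop) _ _)
        (Continuous.intervalIntegrable (by fun_prop) _ _)]
      simp [size, mul_comm]
    simp only [h1, Finset.sum_sub_distrib, ← Finset.mul_sum, M.sum_size, hzm,
      M.sum_integral_cells hVc, hVm]
    ring
  have hcS : |c| * (b - a) ≤ 2 * S * (b - a) := by
    calc |c| * (b - a) = |∑ j, ∫ x in M.left j..M.right j, (V x - (z j).eval x - c)| := by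
          rw [hmean, abs_neg, abs_mul, abs_of_pos hd]
      _ ≤ ∑ j, |∫ x in M.left j..M.right j, (V x - (z j).eval x - c)| :=
          Finset.abs_sum_le_sum_abs _ _
      _ ≤ ∑ j, 2 * S * M.size j := Finset.sum_le_sum fun j _ =>
          abs_integral_le_of_abs_le (M.left_lt_right j).le (hc j)
      _ = 2 * S * (b - a) := by rw [← Finset.mul_sum, M.sum_size]
  have hc2 : |c| ≤ 2 * S := le_of_mul_le_mul_right hcS hd
  have hfin : |V x - (z j).eval x| ≤ 4 * S := by
    have h1 := hc j x hx
    rw [abs_le] at *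
    constructor <;> linarith [h1.1, h1.2, hc2.1, hc2.2]
  calc (V x - (z j).eval x) ^ 2 = |V x - (z j).eval x| ^ 2 := (sq_abs _).symm
    _ ≤ (4 * S) ^ 2 := by gcongr
    _ = 16 * S ^ 2 := by ring
    _ ≤ _ := by gcongr

end Mesh

/-! ### The energy inequality at a fixed time -/

/-- Subtracts the scheme tested with `ξ` from the equation times `ξ`. With `w = U + η - ξ`, the part
of `flux (w) ξ'` free of `η` integrates exactly, leaving `U' ξ²/2` and values at the end points. -/
theorem cell_energy_identity {l r γ fl fr : ℝ} {U U' Ut V : ℝ → ℝ}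
    (hU : ∀ x, HasDerivAt U (U' x) x) (hU' : Continuous U')
    (hV : Continuous V) (heq : ∀ x, Ut x + U x * U' x + γ * V x = 0) {P w wt z ξ : ℝ[X]}
    (hξ : ξ = P - w)
    (hweak : (∫ x in l..r, wt.eval x * ξ.eval x) + (fr * ξ.eval r - fl * ξ.eval l)
      - (∫ x in l..r, flux (w.eval x) * (derivative ξ).eval x)
      + γ * (∫ x in l..r, z.eval x * ξ.eval x) = 0) :
    ∫ x in l..r, (Ut x - wt.eval x) * ξ.eval x =
      ((flux (U l) - fl) * ξ.eval l - (U l * ξ.eval l ^ 2 / 2 - ξ.eval l ^ 3 / 6))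
      - ((flux (U r) - fr) * ξ.eval r - (U r * ξ.eval r ^ 2 / 2 - ξ.eval r ^ 3 / 6))
      - (∫ x in l..r, U' x * ξ.eval x ^ 2 / 2) - (∫ x in l..r, consistency U P w x)
      - γ * ∫ x in l..r, (V x - z.eval x) * ξ.eval x := by
  have hUc : Continuous U := continuous_iff_continuousAt.2 fun x => (hU x).continuousAt
  have hcons : Continuous (consistency U P w) := by unfold consistency; fun_prop
  have hflux : Continuous flux := by unfold flux; fun_prop
  have hftc : ∫ x in l..r, (U' x * ξ.eval x ^ 2 / 2 + consistency U P w x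
        - flux (w.eval x) * (derivative ξ).eval x - U x * U' x * ξ.eval x) =
      (U r * ξ.eval r ^ 2 / 2 - ξ.eval r ^ 3 / 6 - flux (U r) * ξ.eval r)
        - (U l * ξ.eval l ^ 2 / 2 - ξ.eval l ^ 3 / 6 - flux (U l) * ξ.eval l) := by
    refine intervalIntegral.integral_eq_sub_of_hasDerivAt
      (f := fun x => U x * ξ.eval x ^ 2 / 2 - ξ.eval x ^ 3 / 6 - flux (U x) * ξ.eval x)
      (fun x _ => ?_) (Continuous.intervalIntegrable (by fun_prop) _ _)
    have d := ξ.hasDerivAt x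
    have h1 := ((((hU x).mul (d.pow 2)).div_const 2).sub ((d.pow 3).div_const 6)).sub
      ((((hU x).pow 2).div_const 2).mul d)
    refine (h1.congr_deriv ?_)
    simp only [consistency, flux, hξ, eval_sub]
    simp
    ring
  have hsplit : (∫ x in l..r, (Ut x - wt.eval x) * ξ.eval x) =
      (∫ x in l..r, (U' x * ξ.eval x ^ 2 / 2 + consistency U P w x
        - flux (w.eval x) * (derivative ξ).eval x - U x * U' x * ξ.eval x))
      - (∫ x in l..r, U' x * ξ.eval x ^ 2 / 2) - (∫ x in l..r, consistency U P w x)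
      - γ * (∫ x in l..r, (V x - z.eval x) * ξ.eval x)
      - ((∫ x in l..r, wt.eval x * ξ.eval x)
        - (∫ x in l..r, flux (w.eval x) * (derivative ξ).eval x)
        + γ * (∫ x in l..r, z.eval x * ξ.eval x)) := by
    simp only [← intervalIntegral.integral_const_mul]
    rw [← intervalIntegral.integral_sub, ← intervalIntegral.integral_sub,
      ← intervalIntegral.integral_sub, ← intervalIntegral.integral_sub,
      ← intervalIntegral.integral_add, ← intervalIntegral.integral_sub]
    · congr 1
      ext x
      have : Ut x = -(U x * U' x) - γ * V x := by linarith [heq x]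
      rw [this]
      ring
    all_goals exact Continuous.intervalIntegrable (by fun_prop) _ _
  rw [hsplit, hftc]
  linarith

namespace Mesh

variable {a b : ℝ} {M : Mesh a b}

/-- Contribution of the right end point of the cell `j` to the energy balance. -/
def interfaceTerm (U : ℝ → ℝ) (w P : M.Broken) (j : Fin M.N) : ℝ :=
  let q := (P j - w j).eval (M.right j)
  let p := (P (M.next j) - w (M.next j)).eval (M.left (M.next j))
  (flux (U (M.right j)) - M.numFlux w j) * (p - q)
    + U (M.right j) * (q ^ 2 - p ^ 2) / 2 - (q ^ 3 - p ^ 3) / 6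

theorem energy_identity {γ : ℝ} {k : ℕ} {U U' Ut V : ℝ → ℝ}
    (hU : ∀ x, HasDerivAt U (U' x) x) (hU' : Continuous U')
    (hV : Continuous V) (hper : U a = U b) (heq : ∀ x, Ut x + U x * U' x + γ * V x = 0)
    {P w wt z : M.Broken} (hP : M.InV k P) (hw : M.InV k w)
    (hweak : ∀ φ : ℝ[X], φ.natDegree ≤ k → ∀ j,
      (∫ x in M.left j..M.right j, (wt j).eval x * φ.eval x) + M.bracket w φ j
        - (∫ x in M.left j..M.right j, flux ((w j).eval x) * (derivative φ).eval x)
        + γ * (∫ x in M.left j..M.right j, (z j).eval x * φ.eval x) = 0) :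
    ∑ j, ∫ x in M.left j..M.right j, (Ut x - (wt j).eval x) * (P j - w j).eval x =
      ∑ j, interfaceTerm U w P j
      - ∑ j, (∫ x in M.left j..M.right j, U' x * (P j - w j).eval x ^ 2 / 2)
      - ∑ j, (∫ x in M.left j..M.right j, consistency U (P j) (w j) x)
      - γ * ∑ j, ∫ x in M.left j..M.right j, (V x - (z j).eval x) * (P j - w j).eval x := by
  have hcell := fun j => cell_energy_identity (l := M.left j) (r := M.right j)
    (fl := M.numFlux w (M.prev j)) (fr := M.numFlux w j) hU hU' hV heq
    (P := P j) (w := w j) (wt := wt j) (z := z j) rfl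
    (hweak _ (natDegree_sub_le_of_both_le (hP j) (hw j)) j)
  rw [Finset.sum_congr rfl fun j _ => hcell j]
  simp only [Finset.sum_sub_distrib (f := fun j => _ - _), Finset.sum_sub_distrib, ← Finset.mul_sum]
  congr 3
  -- The left end point terms are shifted cyclically by one cell, so that each pairs with the right
  -- end point term at the same interface.
  rw [← M.sum_next fun j => (flux (U (M.left j)) - M.numFlux w (M.prev j)) *
      (P j - w j).eval (M.left j),
    ← M.sum_next fun j => U (M.left j) * (P j - w j).eval (M.left j) ^ 2 / 2,
    ← M.sum_next fun j => (P j - w j).eval (M.left j) ^ 3 / 6]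
  simp only [← Finset.sum_sub_distrib]
  refine Finset.sum_congr rfl fun j _ => ?_
  rw [M.prev_next, M.apply_left_next hper]
  simp only [interfaceTerm]
  ring

theorem interfaceTerm_le {U : ℝ → ℝ} (hper : U a = U b) {w P : M.Broken} {ε : ℝ}
    (hη : ∀ j, ∀ x ∈ Icc (M.left j) (M.right j), |(P j).eval x - U x| ≤ ε) (j : Fin M.N) :
    interfaceTerm U w P j ≤
      4 * (ε * ((P (M.next j) - w (M.next j)).eval (M.left (M.next j)) ^ 2
          + (P j - w j).eval (M.right j) ^ 2) + M.alpha w * ε ^ 2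
        + ε ^ 2 * (|(P (M.next j) - w (M.next j)).eval (M.left (M.next j))|
          + |(P j - w j).eval (M.right j)|)) := by
  have hl := left_mem_Icc.2 (M.left_lt_right (M.next j)).le
  have hr := right_mem_Icc.2 (M.left_lt_right j).le
  have hUn := M.apply_left_next hper j
  have h1 := hη _ _ hl
  have h2 := hη _ _ hr
  rw [hUn] at h1
  have e1 : U (M.right j) + ((P (M.next j)).eval (M.left (M.next j)) - U (M.right j))
      - (P (M.next j) - w (M.next j)).eval (M.left (M.next j)) = M.tracePlus w j := by
    simp only [tracePlus, eval_sub]; ring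
  have e2 : U (M.right j) + ((P j).eval (M.right j) - U (M.right j))
      - (P j - w j).eval (M.right j) = M.traceMinus w j := by
    simp only [traceMinus, eval_sub]; ring
  have h3 : |M.tracePlus w j| ≤ M.alpha w := M.abs_eval_le_alpha w _ hl
  have h4 : |M.traceMinus w j| ≤ M.alpha w := M.abs_eval_le_alpha w _ hr
  rw [← e1] at h3
  rw [← e2] at h4
  have := interface_estimate h1 h2 h3 h4
  rw [e1, e2] at this
  exact this

end Mesh

/-! ### Bounds for the terms of the energy balance -/

namespace Mesh

variable {a b : ℝ} {M : Mesh a b}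

/-- Sums `interface_estimate` with `ε = D * h ^ (k + 1)`, so that `ε ^ 2` equals `D ^ 2 * h * H`
with `H = h ^ (2 * k + 1)`; the factor `h` pays for the number of interfaces. -/
theorem sum_interfaceTerm_le (hab : a < b) {U : ℝ → ℝ} (hper : U a = U b) {w P : M.Broken}
    {k : ℕ} {D L K cN : ℝ} (hD : 0 ≤ D) (hL : ∀ x ∈ Icc a b, |U x| ≤ L)
    (h1 : M.h ≤ 1) (hcN : M.N * M.h ≤ cN) {X : Fin M.N → ℝ} {E : ℝ}
    (hη : ∀ j, ∀ x ∈ Icc (M.left j) (M.right j), |(P j).eval x - U x| ≤ D * M.h ^ (k + 1))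
    (hX : ∀ j, ∀ x ∈ Icc (M.left j) (M.right j), |(P j - w j).eval x| ≤ X j)
    (hE : M.h * ∑ j, X j ^ 2 = K * E) :
    ∑ j, interfaceTerm U w P j ≤
      (8 * (D + D ^ 2) + 4 * D ^ 2 * cN) * (K * E)
        + 4 * D ^ 2 * cN * (L + D + 3) * M.h ^ (2 * k + 1) := by
  have h0 := M.h_pos hab
  set h := M.h
  set s := h ^ k with hs
  have hs0 : 0 ≤ s := by positivity
  have hs1 : s ≤ 1 := pow_le_one₀ h0.le h1
  have hpow : h ^ (k + 1) = h * s := by rw [hs]; ring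
  set H := h ^ (2 * k + 1) with hH
  have hHs : H = h * s ^ 2 := by rw [hH, hs]; ring
  have hH0 : 0 ≤ H := by positivity
  have hH1 : H ≤ 1 := pow_le_one₀ h0.le h1
  have hL0 : 0 ≤ L := (abs_nonneg _).trans (hL a (left_mem_Icc.2 hab.le))
  have hX0 : ∀ j, 0 ≤ X j := fun j =>
    (abs_nonneg _).trans (hX j _ (left_mem_Icc.2 (M.left_lt_right j).le))
  rw [hpow] at hη
  have hε1 : D * (h * s) ≤ D * h := by gcongr; nlinarith
  have hε2 : (D * (h * s)) ^ 2 = D ^ 2 * h * H := by rw [hHs]; ring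
  have hbound : ∀ j, interfaceTerm U w P j ≤
      4 * (D * h * (X (M.next j) ^ 2 + X j ^ 2) + M.alpha w * (D ^ 2 * h * H)
        + D ^ 2 * h * (2 * H + X (M.next j) ^ 2 + X j ^ 2)) := by
    intro j
    refine (interfaceTerm_le hper hη j).trans ?_
    have hp := hX (M.next j) _ (left_mem_Icc.2 (M.left_lt_right (M.next j)).le)
    have hq := hX j _ (right_mem_Icc.2 (M.left_lt_right j).le)
    rw [hε2]
    have hHX : ∀ i, H * X i ≤ H + X i ^ 2 := fun i => by
      nlinarith [sq_nonneg (H - X i), sq_nonneg (X i), mul_le_mul_of_nonneg_left hH1 hH0]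
    have hfin : D ^ 2 * h * H * (|(P (M.next j) - w (M.next j)).eval (M.left (M.next j))|
          + |(P j - w j).eval (M.right j)|) ≤
        D ^ 2 * h * (2 * H + X (M.next j) ^ 2 + X j ^ 2) := by
      calc _ ≤ D ^ 2 * h * H * (X (M.next j) + X j) := by gcongr
        _ = D ^ 2 * h * (H * X (M.next j) + H * X j) := by ring
        _ ≤ _ := by
          refine mul_le_mul_of_nonneg_left ?_ (by positivity)
          linarith [hHX j, hHX (M.next j)]
    have hfst : D * (h * s) * ((P (M.next j) - w (M.next j)).eval (M.left (M.next j)) ^ 2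
          + (P j - w j).eval (M.right j) ^ 2) ≤ D * h * (X (M.next j) ^ 2 + X j ^ 2) := by
      rw [← sq_abs (eval _ (P (M.next j) - _)), ← sq_abs (eval _ (P j - _))]
      gcongr
    linarith
  have hsumX : M.h * ∑ j, X (M.next j) ^ 2 = K * E := by
    rw [M.sum_next fun j => X j ^ 2, hE]
  have hKE : 0 ≤ K * E := by
    rw [← hE]; exact mul_nonneg h0.le (Finset.sum_nonneg fun j _ => sq_nonneg _)
  have hNh : 0 ≤ M.N * h := by positivity
  -- `Y` dominates every `X j`, hence the maximum of `ξ`, and so bounds `α` by the energy. It may be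
  -- large, but `α` occurs only multiplied by `H`, and `Y * H` is controlled by `h * Y ^ 2 = K * E`
  -- and `H`.
  set Y := √(∑ j, X j ^ 2) with hY
  have hY2 : h * Y ^ 2 = K * E := by
    rw [hY, Real.sq_sqrt (Finset.sum_nonneg fun j _ => sq_nonneg _), hE]
  have hXY : ∀ j, X j ≤ Y := fun j => by
    apply Real.le_sqrt_of_sq_le
    exact Finset.single_le_sum (fun i _ => sq_nonneg (X i)) (Finset.mem_univ j)
  have hα : M.alpha w ≤ L + D + Y := by
    refine M.alpha_le w (M.N_pos hab) fun j x hx => ?_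
    have e1 := hL x (M.cell_subset j hx)
    have e2 := hη j x hx
    have e3 := (hX j x hx).trans (hXY j)
    have e4 : D * (h * s) ≤ D := by nlinarith
    rw [eval_sub] at e3
    rw [abs_le] at *
    constructor <;> linarith [e1.1, e1.2, e2.1, e2.2, e3.1, e3.2]
  have hαH : M.alpha w * H ≤ (L + D) * H + (K * E + H) := by
    have hYH : Y * H ≤ K * E + H := by
      rw [← hY2, hHs]
      have hs4 : s ^ 4 ≤ s ^ 2 := pow_le_pow_of_le_one hs0 hs1 (by norm_num)
      nlinarith [mul_nonneg h0.le (sq_nonneg (Y - s ^ 2)), mul_nonneg h0.le (sq_nonneg Y),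
        mul_nonneg h0.le (sub_nonneg.2 hs4), mul_nonneg h0.le (sq_nonneg s)]
    calc _ ≤ (L + D + Y) * H := by gcongr
      _ = (L + D) * H + Y * H := by ring
      _ ≤ _ := by gcongr
  calc ∑ j, interfaceTerm U w P j
      ≤ ∑ j, 4 * (D * h * (X (M.next j) ^ 2 + X j ^ 2) + M.alpha w * (D ^ 2 * h * H)
        + D ^ 2 * h * (2 * H + X (M.next j) ^ 2 + X j ^ 2)) :=
        Finset.sum_le_sum fun j _ => hbound j
    _ = 4 * ((D + D ^ 2) * (M.h * ∑ j, X (M.next j) ^ 2 + M.h * ∑ j, X j ^ 2)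
        + D ^ 2 * (M.N * h) * (M.alpha w * H + 2 * H)) := by
        rw [← Finset.mul_sum]
        simp only [Finset.sum_add_distrib, ← Finset.mul_sum, Finset.sum_const, Finset.card_univ,
          Fintype.card_fin, nsmul_eq_mul]
        ring
    _ ≤ 4 * ((D + D ^ 2) * (K * E + K * E) + D ^ 2 * (M.N * h) *
          ((L + D) * H + (K * E + H) + 2 * H)) := by
        rw [hsumX, hE]
        gcongr
    _ ≤ 4 * ((D + D ^ 2) * (K * E + K * E) + D ^ 2 * cN *
          ((L + D) * H + (K * E + H) + 2 * H)) := by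
        have : 0 ≤ (L + D) * H + (K * E + H) + 2 * H := by positivity
        gcongr
    _ = _ := by ring

theorem nonlocal_term_le (hab : a < b) {γ : ℝ} {U V : ℝ → ℝ} (hU : Continuous U)
    (hV : ∀ x, HasDerivAt V (U x) x) (hVm : ∫ x in a..b, V x = 0) {w z ξ : M.Broken}
    (hz : ∀ j, ∀ x ∈ Icc (M.left j) (M.right j),
      (z j).eval x = (z j).eval (M.right j) - ∫ y in x..M.right j, (w j).eval y)
    (hzc : ∀ i j : Fin M.N, (j : ℕ) = i + 1 → (z i).eval (M.right i) = (z j).eval (M.left j))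
    (hzm : ∑ j, ∫ x in M.left j..M.right j, (z j).eval x = 0)
    (hξ : ∀ j, ∫ x in M.left j..M.right j, (ξ j).eval x ^ 2 ≤
      ∫ x in M.left j..M.right j, (U x - (w j).eval x) ^ 2) :
    -(γ * ∑ j, ∫ x in M.left j..M.right j, (V x - (z j).eval x) * (ξ j).eval x) ≤
      |γ| * (16 * (b - a) ^ 2 + 1) *
        ∑ j, ∫ x in M.left j..M.right j, (U x - (w j).eval x) ^ 2 := by
  have hVc : Continuous V := continuous_iff_continuousAt.2 fun x => (hV x).continuousAt
  set E : Fin M.N → ℝ := fun j => ∫ x in M.left j..M.right j, (U x - (w j).eval x) ^ 2 with hE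
  refine (neg_le_abs _).trans ?_
  rw [abs_mul, mul_assoc]
  refine mul_le_mul_of_nonneg_left ?_ (abs_nonneg γ)
  calc _ ≤ ∑ j, |∫ x in M.left j..M.right j, (V x - (z j).eval x) * (ξ j).eval x| :=
        Finset.abs_sum_le_sum_abs _ _
    _ ≤ ∑ j, (16 * ((b - a) * ∑ j, E j) * M.size j + E j) := by
        refine Finset.sum_le_sum fun j _ => ?_
        refine (intervalIntegral.abs_integral_le_integral_abs (M.left_lt_right j).le).trans ?_
        have e1 : ∫ x in M.left j..M.right j, |(V x - (z j).eval x) * (ξ j).eval x| ≤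
            ∫ x in M.left j..M.right j,
              (16 * ((b - a) * ∑ j, E j) + (ξ j).eval x ^ 2) := by
          refine intervalIntegral.integral_mono_on (M.left_lt_right j).le
            (Continuous.intervalIntegrable (by fun_prop) _ _)
            (Continuous.intervalIntegrable (by fun_prop) _ _) fun x hx => ?_
          have e2 := sq_antiderivative_error_le hab hU hV hVm hz hzc hzm j hx
          rw [abs_mul]
          rw [← sq_abs] at e2 ⊢
          have e3 := abs_nonneg (V x - (z j).eval x)
          have e4 := abs_nonneg ((ξ j).eval x)
          have e5 := two_mul_le_add_sq |V x - (z j).eval x| |(ξ j).eval x|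
          nlinarith [mul_nonneg e3 e4]
        refine e1.trans ?_
        rw [intervalIntegral.integral_add (Continuous.intervalIntegrable (by fun_prop) _ _)
          (Continuous.intervalIntegrable (by fun_prop) _ _), intervalIntegral.integral_const,
          smul_eq_mul, mul_comm (M.right j - M.left j)]
        exact add_le_add le_rfl (hξ j)
    _ = _ := by
        rw [Finset.sum_add_distrib, ← Finset.mul_sum, M.sum_size]
        ring

-- The estimate at a frozen time, with all data entering only through `B`, `L`, `ρ`, `γ`, `k` and
-- the interval; this makes the constant uniform in time, mesh and discrete solution.
set_option maxHeartbeats 800000 in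
theorem exists_energy_rate_bound {a b ρ B L : ℝ} (γ : ℝ) (hab : a < b) (hρ : 0 < ρ) (hB : 0 ≤ B)
    (k : ℕ) : ∃ C, 0 ≤ C ∧ ∀ M : Mesh a b, M.IsRegular ρ → M.h ≤ 1 →
      ∀ U U' Ut V : ℝ → ℝ, (∀ x, HasDerivAt U (U' x) x) → Continuous U' → Continuous Ut →
      (∀ x, HasDerivAt V (U x) x) → U a = U b → (∫ x in a..b, V x = 0) →
      (∀ x, Ut x + U x * U' x + γ * V x = 0) →
      (∀ x ∈ Icc a b, |U x| ≤ L) → (∀ x ∈ Icc a b, |U' x| ≤ L) →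
      (∀ j, ∃ Q : ℝ[X], Q.natDegree ≤ k ∧
        ∀ x ∈ Icc (M.left j) (M.right j), |U x - Q.eval x| ≤ B * M.h ^ (k + 1)) →
      (∀ j, ∃ Q : ℝ[X], Q.natDegree ≤ k ∧
        ∀ x ∈ Icc (M.left j) (M.right j), |Ut x - Q.eval x| ≤ B * M.h ^ k) →
      ∀ w wt z : M.Broken, M.InV k w → M.InV k wt →
      (∀ φ : ℝ[X], φ.natDegree ≤ k → ∀ j,
        (∫ x in M.left j..M.right j, (wt j).eval x * φ.eval x) + M.bracket w φ j
          - (∫ x in M.left j..M.right j, flux ((w j).eval x) * (derivative φ).eval x)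
          + γ * (∫ x in M.left j..M.right j, (z j).eval x * φ.eval x) = 0) →
      (∀ j, ∀ x ∈ Icc (M.left j) (M.right j),
        (z j).eval x = (z j).eval (M.right j) - ∫ y in x..M.right j, (w j).eval y) →
      (∀ i j : Fin M.N, (j : ℕ) = i + 1 → (z i).eval (M.right i) = (z j).eval (M.left j)) →
      (∑ j, ∫ x in M.left j..M.right j, (z j).eval x = 0) →
      ∑ j, ∫ x in M.left j..M.right j, (U x - (w j).eval x) * (Ut x - (wt j).eval x) ≤
        C * ((∑ j, ∫ x in M.left j..M.right j, (U x - (w j).eval x) ^ 2) + M.h ^ (2 * k + 1)) := by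
  -- A negative `L` contradicts the bound on `U` at `a`, so nothing is claimed in that case.
  rcases lt_or_ge L 0 with hLneg | hL0
  · refine ⟨0, le_rfl, fun M _ _ U _ _ _ _ _ _ _ _ _ _ hUL => ?_⟩
    exact absurd ((abs_nonneg _).trans (hUL a (left_mem_Icc.2 hab.le))) (not_le.2 hLneg)
  obtain ⟨Kp, hKp, hproj⟩ := exists_projection_bound k
  obtain ⟨K₀, hK₀, hinv⟩ := exists_inverse_bound k
  set D := Kp * B with hDdef
  -- The two summands come from the inverse inequalities for `ξ` and for its derivative, with the
  -- cell length replaced by `ρ * h`.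
  set K := K₀ / ρ + K₀ / ρ ^ 3 with hKdef
  set cN := (b - a) / ρ with hcN
  have hd : 0 < b - a := sub_pos.2 hab
  have hD0 : 0 ≤ D := by positivity
  have hK0 : 0 ≤ K := by positivity
  have hcN0 : 0 ≤ cN := by positivity
  set c₁ := (8 * (D + D ^ 2) + 4 * D ^ 2 * cN) * K + L + (L * D + D + D ^ 2) * K
    + |γ| * (16 * (b - a) ^ 2 + 1) with hc₁
  set c₂ := 4 * D ^ 2 * cN * (L + D + 3) + (L * D + D + D ^ 2) * cN + B * D * cN with hc₂
  have hc₁0 : 0 ≤ c₁ := by positivity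
  have hc₂0 : 0 ≤ c₂ := by positivity
  refine ⟨c₁ + c₂, by positivity, ?_⟩
  intro M hM h1 U U' Ut V hU hU' hUt hV hper hVm heq hUL hU'L hQ hQt w wt z hw hwt hweak hz hzc hzm
  have hUc : Continuous U := continuous_iff_continuousAt.2 fun x => (hU x).continuousAt
  have hVc : Continuous V := continuous_iff_continuousAt.2 fun x => (hV x).continuousAt
  have h0 := M.h_pos hab
  have hNh : M.N * M.h ≤ cN := M.card_mul_h_le hρ hM
  have hNh0 : 0 ≤ M.N * M.h := by positivity
  set h := M.h with hh
  have hlr := fun j => (M.left_lt_right j)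
  have hsz : ∀ j, M.right j - M.left j ≤ h := M.size_le_h
  have hszl : ∀ j, ρ * h ≤ M.right j - M.left j := hM
  have hPex := fun j => exists_l2_projection k (hlr j) hUc
  choose P hPd hPo using hPex
  have hP : ∀ j, IsL2Projection k (M.left j) (M.right j) U (P j) := fun j => ⟨hPd j, hPo j⟩
  choose Q hQd hQb using hQ
  choose Qt hQtd hQtb using hQt
  have hη : ∀ j, ∀ x ∈ Icc (M.left j) (M.right j), |(P j).eval x - U x| ≤ D * h ^ (k + 1) := by
    intro j x hx
    refine (hproj _ _ _ (hlr j) U hUc _ _ (hP j) (hQd j) (hQb j) x hx).trans_eq ?_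
    rw [hDdef]; ring
  set E : Fin M.N → ℝ := fun j => ∫ x in M.left j..M.right j, (U x - (w j).eval x) ^ 2 with hE
  have hE0 : ∀ j, 0 ≤ E j := fun j =>
    intervalIntegral.integral_nonneg (hlr j).le fun _ _ => sq_nonneg _
  have hξE : ∀ j, ∫ x in M.left j..M.right j, (P j - w j).eval x ^ 2 ≤ E j := fun j =>
    (hP j).integral_sq_le (hlr j).le hUc (hw j)
  -- Common bound for `ξ` and `h ξ'` on the cell `j`. The total error `E j` may stand for the norm
  -- of `ξ`, since the projection of `U - w` is `ξ`.
  set X : Fin M.N → ℝ := fun j => √(K * E j / h) with hX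
  have hX2 : ∀ j, h * X j ^ 2 = K * E j := fun j => by
    have := hE0 j
    simp only [hX]
    rw [Real.sq_sqrt (by positivity)]
    field_simp
  have hξd : ∀ j, (P j - w j).natDegree ≤ k := fun j => natDegree_sub_le_of_both_le (hPd j) (hw j)
  have hξX : ∀ j, ∀ x ∈ Icc (M.left j) (M.right j), |(P j - w j).eval x| ≤ X j := by
    intro j x hx
    have e1 := (hinv _ _ (hlr j) _ (hξd j) x hx).1.trans
      (mul_le_mul_of_nonneg_left (hξE j) hK₀.le)
    apply Real.le_sqrt_of_sq_le
    rw [sq_abs, le_div_iff₀ h0]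
    have e2 : ρ * h * (P j - w j).eval x ^ 2 ≤ K₀ * E j :=
      (mul_le_mul_of_nonneg_right (hszl j) (sq_nonneg _)).trans e1
    have e3 : 0 ≤ K₀ / ρ ^ 3 * E j := mul_nonneg (by positivity) (hE0 j)
    calc (P j - w j).eval x ^ 2 * h = ρ * h * (P j - w j).eval x ^ 2 / ρ := by field_simp
      _ ≤ K₀ * E j / ρ := by gcongr
      _ = K₀ / ρ * E j := by ring
      _ ≤ K * E j := by rw [hKdef, add_mul]; linarith
  have hξX' : ∀ j, ∀ x ∈ Icc (M.left j) (M.right j),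
      h * |(derivative (P j - w j)).eval x| ≤ X j := by
    intro j x hx
    have e1 := (hinv _ _ (hlr j) _ (hξd j) x hx).2.trans
      (mul_le_mul_of_nonneg_left (hξE j) hK₀.le)
    apply Real.le_sqrt_of_sq_le
    rw [mul_pow, sq_abs, le_div_iff₀ h0]
    have e2 : (ρ * h) ^ 3 * (derivative (P j - w j)).eval x ^ 2 ≤ K₀ * E j := by
      refine (mul_le_mul_of_nonneg_right ?_ (sq_nonneg _)).trans e1
      exact pow_le_pow_left₀ (by positivity) (hszl j) 3
    have e3 : 0 ≤ K₀ / ρ * E j := mul_nonneg (by positivity) (hE0 j)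
    calc h ^ 2 * (derivative (P j - w j)).eval x ^ 2 * h
        = (ρ * h) ^ 3 * (derivative (P j - w j)).eval x ^ 2 / ρ ^ 3 := by field_simp
      _ ≤ K₀ * E j / ρ ^ 3 := by gcongr
      _ = K₀ / ρ ^ 3 * E j := by ring
      _ ≤ K * E j := by rw [hKdef, add_mul]; linarith
  have hsumX : h * ∑ j, X j ^ 2 = K * ∑ j, E j := by
    rw [Finset.mul_sum, Finset.mul_sum]
    exact Finset.sum_congr rfl fun j _ => hX2 j
  set H := h ^ (2 * k + 1) with hH
  have hH0 : 0 ≤ H := by positivity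
  have hEs : 0 ≤ ∑ j, E j := Finset.sum_nonneg fun j _ => hE0 j
  have hsumconst : ∀ c : ℝ, 0 ≤ c → ∑ _j : Fin M.N, c * h * H ≤ c * cN * H := fun c hc => by
    rw [Finset.sum_const, Finset.card_univ, Fintype.card_fin, nsmul_eq_mul]
    calc (M.N : ℝ) * (c * h * H) = c * (M.N * h) * H := by ring
      _ ≤ _ := by gcongr
  -- replacing the test function `e` by `ξ`
  have s1 : ∑ j, ∫ x in M.left j..M.right j, (U x - (w j).eval x) * (Ut x - (wt j).eval x) ≤
      (∑ j, ∫ x in M.left j..M.right j, (Ut x - (wt j).eval x) * (P j - w j).eval x)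
        + B * D * cN * H := by
    refine le_trans (Finset.sum_le_sum fun j _ => (hP j).integral_mul_error_le (hlr j).le (hsz j)
      h0 hD0 hB hUc hUt (hwt j) (hQtd j) (hη j) (hQtb j)) ?_
    rw [Finset.sum_add_distrib]
    exact add_le_add le_rfl (hsumconst _ (by positivity))
  have s2 := energy_identity hU hU' hVc hper heq (P := P) (w := w) (wt := wt) (z := z)
    hPd hw hweak
  have s3 := sum_interfaceTerm_le hab hper hD0 hUL h1 hNh hη hξX hsumX
  have s4 : -∑ j, (∫ x in M.left j..M.right j, U' x * (P j - w j).eval x ^ 2 / 2) ≤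
      L * ∑ j, E j := by
    rw [← Finset.sum_neg_distrib, Finset.mul_sum]
    refine Finset.sum_le_sum fun j _ => ?_
    refine le_trans ?_ (mul_le_mul_of_nonneg_left (hξE j) hL0)
    rw [← intervalIntegral.integral_neg, ← intervalIntegral.integral_const_mul]
    refine intervalIntegral.integral_mono_on (hlr j).le
      (Continuous.intervalIntegrable (by fun_prop) _ _)
      (Continuous.intervalIntegrable (by fun_prop) _ _) fun x hx => ?_
    have := (abs_le.1 (hU'L x (M.cell_subset j hx))).1
    nlinarith [sq_nonneg ((P j - w j).eval x)]
  have s5 : -∑ j, (∫ x in M.left j..M.right j, consistency U (P j) (w j) x) ≤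
      (L * D + D + D ^ 2) * cN * H + (L * D + D + D ^ 2) * K * ∑ j, E j := by
    rw [← Finset.sum_neg_distrib]
    have hc : 0 ≤ L * D + D + D ^ 2 := by positivity
    calc _ ≤ ∑ j, ((L * D + D + D ^ 2) * h * H + (L * D + D + D ^ 2) * K * E j) := by
          refine Finset.sum_le_sum fun j _ => ?_
          refine (neg_le_abs _).trans (((hP j).abs_integral_consistency_le (hlr j).le (hsz j) h0 h1
            hU (fun x hx => hU'L x (M.cell_subset j hx)) (hw j) (hη j) (hξX j)
            (hξX' j)).trans_eq ?_)
          rw [mul_assoc _ K, ← hX2 j]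
          ring
      _ ≤ _ := by
          rw [Finset.sum_add_distrib]
          exact add_le_add (hsumconst _ hc) (Finset.mul_sum _ _ _).ge
  have s6 : -(γ * ∑ j, ∫ x in M.left j..M.right j, (V x - (z j).eval x) * (P j - w j).eval x) ≤
      |γ| * (16 * (b - a) ^ 2 + 1) * ∑ j, E j :=
    nonlocal_term_le (ξ := fun j => P j - w j) hab hUc hV hVm hz hzc hzm hξE
  have hfin : c₁ * ∑ j, E j + c₂ * H ≤ (c₁ + c₂) * (∑ j, E j + H) := by
    nlinarith [mul_nonneg hc₁0 hH0, mul_nonneg hc₂0 hEs]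
  refine le_trans ?_ hfin
  rw [hc₁, hc₂]
  rw [s2] at s1
  linarith

end Mesh

/-! ### Time evolution of the energy -/

/-- Differentiation under the integral sign with a Lipschitz bound centred at `t` alone. The
coefficients of `u_h` are only assumed differentiable in time, so their derivatives need not be
bounded near `t`. -/
theorem hasDerivAt_integral_sq {l r t K : ℝ} (hlr : l ≤ r) {S : Set ℝ} (hS : S ∈ nhds t)
    {e : ℝ → ℝ → ℝ} {e' : ℝ → ℝ} (he : ∀ s ∈ S, Continuous (e s)) (he' : Continuous e')
    (hd : ∀ x, HasDerivAt (fun s => e s x) (e' x) t)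
    (hlip : ∀ s ∈ S, ∀ x ∈ Icc l r, |e s x - e t x| ≤ K * |s - t|) :
    HasDerivAt (fun s => ∫ x in l..r, e s x ^ 2) (2 * ∫ x in l..r, e t x * e' x) t := by
  have htc := he t (mem_of_mem_nhds hS)
  obtain ⟨B, hB⟩ := (isCompact_Icc (a := l) (b := r)).exists_bound_of_continuousOn htc.continuousOn
  have hS' : S ∩ Metric.ball t 1 ∈ nhds t := Filter.inter_mem hS (Metric.ball_mem_nhds t one_pos)
  have hint : ∀ {f : ℝ → ℝ}, Continuous f → MeasureTheory.IntegrableOn f (Ioc l r) := fun hf =>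
    (hf.integrableOn_Icc).mono_set Ioc_subset_Icc_self
  have main := hasFDerivAt_integral_of_dominated_loc_of_lip' (𝕜 := ℝ)
    (μ := MeasureTheory.volume.restrict (Ioc l r)) (F := fun s x => e s x ^ 2)
    (F' := fun x => ContinuousLinearMap.toSpanSingleton ℝ (2 * (e t x * e' x)))
    (bound := fun _ => K * (K + 2 * B)) hS'
    (fun s hs => ((he s hs.1).pow 2).aestronglyMeasurable)
    (hint (htc.pow 2))
    (((ContinuousLinearMap.toSpanSingletonCLE (𝕜 := ℝ) (E := ℝ)).continuous.comp
      (by fun_prop : Continuous fun x => 2 * (e t x * e' x))).aestronglyMeasurable)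
    (by
      rw [MeasureTheory.ae_restrict_iff' measurableSet_Ioc]
      refine Filter.Eventually.of_forall fun x hx s hs => ?_
      have hx' := Ioc_subset_Icc_self hx
      have h1 := hlip s hs.1 x hx'
      have h2 : |s - t| ≤ 1 := by
        have := hs.2
        rw [Metric.mem_ball, Real.dist_eq] at this
        exact this.le
      have h3 : |e t x| ≤ B := hB x hx'
      have hK : 0 ≤ K * |s - t| := (abs_nonneg _).trans h1
      rw [Real.norm_eq_abs, Real.norm_eq_abs]
      -- The sign of `K` can be read off from the Lipschitz bound only when `s ≠ t`.
      rcases (abs_nonneg (s - t)).eq_or_lt with h0 | h0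
      · rw [← h0, mul_zero] at h1 ⊢
        have : e s x = e t x := sub_eq_zero.1 (abs_nonpos_iff.1 h1)
        simp [this]
      have hK0 : 0 ≤ K := nonneg_of_mul_nonneg_left hK h0
      have h4 : |e s x + e t x| ≤ K + 2 * B := by
        have h5 : K * |s - t| ≤ K := by nlinarith
        rw [abs_le] at h1 h3 ⊢
        constructor <;> linarith [h1.1, h1.2, h3.1, h3.2]
      calc |e s x ^ 2 - e t x ^ 2| = |e s x - e t x| * |e s x + e t x| := by
            rw [← abs_mul]; congr 1; ring
        _ ≤ K * |s - t| * (K + 2 * B) := by gcongr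
        _ = _ := by ring)
    (hint continuous_const)
    (Filter.Eventually.of_forall fun x => by
      have h : HasDerivAt (fun s => e s x ^ 2) (2 * (e t x * e' x)) t :=
        ((hd x).pow 2).congr_deriv (by simp; ring)
      exact h.hasFDerivAt)
  have h2 := main.2.hasDerivAt
  rw [ContinuousLinearMap.integral_apply main.1] at h2
  simp only [ContinuousLinearMap.toSpanSingleton_apply, one_smul] at h2
  simp only [intervalIntegral.integral_of_le hlr]
  rw [← MeasureTheory.integral_const_mul]
  exact h2

theorem continuousOn_integral_sq {l r T : ℝ} (hT : 0 ≤ T) {e : ℝ × ℝ → ℝ}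
    (he : ContinuousOn e (univ ×ˢ Icc 0 T)) :
    ContinuousOn (fun s => ∫ x in l..r, e (x, s) ^ 2) (Icc 0 T) := by
  -- Clamping time to `[0, T]` gives a function continuous on the whole plane, which covers
  -- continuity at both end times.
  have h1 : Continuous fun p : ℝ × ℝ => e (p.2, (projIcc 0 T hT p.1 : ℝ)) :=
    he.comp_continuous (by fun_prop) fun p => ⟨mem_univ _, (projIcc 0 T hT p.1).2⟩
  have h2 : Continuous fun s => ∫ x in l..r, e (x, (projIcc 0 T hT s : ℝ)) ^ 2 := by
    apply intervalIntegral.continuous_parametric_intervalIntegral_of_continuous'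
    exact h1.pow 2
  refine h2.continuousOn.congr fun s hs => ?_
  simp only [projIcc_of_mem hT hs]

/-- With the integrating factor `exp (-C s)` the energy plus `H` decreases. The derivative is used
only at interior times; continuity reaches the end points. -/
theorem gronwall_energy {T C H : ℝ} {E E' : ℝ → ℝ} (hE : ContinuousOn E (Icc 0 T))
    (hE' : ∀ t ∈ Ioo 0 T, HasDerivAt E (E' t) t) (hb : ∀ t ∈ Ioo 0 T, E' t ≤ C * (E t + H))
    {t : ℝ} (ht : t ∈ Icc 0 T) : E t + H ≤ Real.exp (C * t) * (E 0 + H) := by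
  have hder : ∀ s ∈ Ioo 0 T, HasDerivAt (fun s => Real.exp (-(C * s)) * (E s + H))
      (Real.exp (-(C * s)) * (E' s - C * (E s + H))) s := by
    intro s hs
    have h1 : HasDerivAt (fun s => Real.exp (-(C * s))) (Real.exp (-(C * s)) * (-(C * 1))) s :=
      (((hasDerivAt_id s).const_mul C).neg).exp
    refine (h1.mul ((hE' s hs).add_const H)).congr_deriv ?_
    ring
  have hanti : AntitoneOn (fun s => Real.exp (-(C * s)) * (E s + H)) (Icc 0 T) := by
    apply antitoneOn_of_deriv_nonpos (convex_Icc 0 T)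
    · exact (by fun_prop : Continuous fun s => Real.exp (-(C * s))).continuousOn.mul
        (hE.add continuousOn_const)
    · rw [interior_Icc]
      exact fun s hs => (hder s hs).differentiableAt.differentiableWithinAt
    · rw [interior_Icc]
      intro s hs
      rw [(hder s hs).deriv]
      exact mul_nonpos_of_nonneg_of_nonpos (Real.exp_pos _).le (sub_nonpos.2 (hb s hs))
  have h0 := hanti (left_mem_Icc.2 (ht.1.trans ht.2)) ht ht.1
  simp only [mul_zero, neg_zero, Real.exp_zero, one_mul] at h0
  calc E t + H = Real.exp (C * t) * (Real.exp (-(C * t)) * (E t + H)) := by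
        rw [← mul_assoc, ← Real.exp_add]; simp
    _ ≤ _ := by gcongr

theorem natDegree_polyOfCoeffs_le {k : ℕ} (c : Fin (k + 1) → ℝ) :
    (polyOfCoeffs c).natDegree ≤ k :=
  natDegree_sum_le_of_forall_le _ _ fun i _ =>
    (natDegree_monomial_le _).trans (Nat.lt_succ_iff.1 i.2)

/-- Time derivative of a polynomial valued function, computed coefficientwise. -/
def polyDeriv (T : ℝ) (k : ℕ) (p : ℝ → ℝ[X]) (t : ℝ) : ℝ[X] :=
  polyOfCoeffs fun i : Fin (k + 1) => derivWithin (fun s => (p s).coeff i) (Icc 0 T) t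

/-! ### Polynomials depending on time -/

section PolynomialCurve

variable {T : ℝ} {k : ℕ} {p : ℝ → ℝ[X]}

theorem eval_eq_sum_coeff (hp : ∀ t ∈ Icc 0 T, (p t).natDegree ≤ k) {t : ℝ} (ht : t ∈ Icc 0 T)
    (x : ℝ) : (p t).eval x = ∑ i : Fin (k + 1), (p t).coeff i * x ^ (i : ℕ) := by
  conv_lhs => rw [← polyOfCoeffs_coeff (hp t ht), eval_polyOfCoeffs]

theorem hasDerivWithinAt_eval (hp : ∀ t ∈ Icc 0 T, (p t).natDegree ≤ k)
    (hd : ∀ i, DifferentiableOn ℝ (fun s => (p s).coeff i) (Icc 0 T)) {t : ℝ} (ht : t ∈ Icc 0 T)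
    (x : ℝ) :
    HasDerivWithinAt (fun s => (p s).eval x) ((polyDeriv T k p t).eval x) (Icc 0 T) t := by
  have h1 : HasDerivWithinAt (fun s => ∑ i : Fin (k + 1), (p s).coeff i * x ^ (i : ℕ))
      ((polyDeriv T k p t).eval x) (Icc 0 T) t := by
    rw [polyDeriv, eval_polyOfCoeffs]
    exact HasDerivWithinAt.fun_sum fun i _ => ((hd i t ht).hasDerivWithinAt).mul_const _
  exact h1.congr (fun s hs => eval_eq_sum_coeff hp hs x) (eval_eq_sum_coeff hp ht x)

theorem continuousOn_eval (hp : ∀ t ∈ Icc 0 T, (p t).natDegree ≤ k)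
    (hd : ∀ i, DifferentiableOn ℝ (fun s => (p s).coeff i) (Icc 0 T)) :
    ContinuousOn (fun q : ℝ × ℝ => (p q.2).eval q.1) (univ ×ˢ Icc 0 T) := by
  have h1 : ContinuousOn (fun q : ℝ × ℝ => ∑ i : Fin (k + 1), (p q.2).coeff i * q.1 ^ (i : ℕ))
      (univ ×ˢ Icc 0 T) := by
    refine continuousOn_finsetSum _ fun i _ => ContinuousOn.mul ?_ (by fun_prop)
    exact (hd i).continuousOn.comp continuousOn_snd fun q hq => hq.2
  exact h1.congr fun q hq => eval_eq_sum_coeff hp hq.2 q.1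

theorem exists_lipschitz_eval (hp : ∀ t ∈ Icc 0 T, (p t).natDegree ≤ k)
    (hd : ∀ i, DifferentiableOn ℝ (fun s => (p s).coeff i) (Icc 0 T)) {t : ℝ} (ht : t ∈ Ioo 0 T)
    (l r : ℝ) :
    ∃ K, ∀ᶠ s in nhds t, ∀ x ∈ Icc l r, |(p s).eval x - (p t).eval x| ≤ K * |s - t| := by
  have hnh : Icc 0 T ∈ nhds t := Icc_mem_nhds ht.1 ht.2
  have h1 : ∀ i : Fin (k + 1), ∃ K, 0 ≤ K ∧
      ∀ᶠ s in nhds t, |(p s).coeff i - (p t).coeff i| ≤ K * |s - t| := by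
    intro i
    have hda := (hd i).differentiableAt hnh
    obtain ⟨K, hK, h⟩ := hda.hasDerivAt.isBigO_sub.exists_pos
    exact ⟨K, hK.le, h.bound⟩
  choose K hK0 hK using h1
  set R := max |l| |r|
  refine ⟨∑ i : Fin (k + 1), K i * R ^ (i : ℕ), ?_⟩
  filter_upwards [Filter.eventually_all.2 hK, hnh] with s hs hsT x hx
  have hxR : |x| ≤ R := abs_le_max_abs_abs hx.1 hx.2
  rw [eval_eq_sum_coeff hp hsT, eval_eq_sum_coeff hp (Ioo_subset_Icc_self ht),
    ← Finset.sum_sub_distrib, Finset.sum_mul]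
  refine (Finset.abs_sum_le_sum_abs _ _).trans (Finset.sum_le_sum fun i _ => ?_)
  rw [← sub_mul, abs_mul, abs_pow]
  calc _ ≤ K i * |s - t| * R ^ (i : ℕ) := by
        have := hs i
        have := hK0 i
        gcongr
    _ = _ := by ring

/-- Evolution of the squared `L²` distance of a smooth function and a polynomial on one cell. -/
theorem hasDerivAt_cell_energy {n : ℕ} (hT : 0 < T) {g : ℝ × ℝ → ℝ}
    (hg : ContDiffOn ℝ (n + 1 : ℕ) g (univ ×ˢ Icc 0 T))
    (hp : ∀ t ∈ Icc 0 T, (p t).natDegree ≤ k)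
    (hd : ∀ i, DifferentiableOn ℝ (fun s => (p s).coeff i) (Icc 0 T)) {t : ℝ} (ht : t ∈ Ioo 0 T)
    {l r : ℝ} (hlr : l ≤ r) :
    HasDerivAt (fun s => ∫ x in l..r, (g (x, s) - (p s).eval x) ^ 2)
      (2 * ∫ x in l..r, (g (x, t) - (p t).eval x) *
        (stripDeriv T (0, 1) g (x, t) - (polyDeriv T k p t).eval x)) t := by
  have ht' := Ioo_subset_Icc_self ht
  have hnh : Icc 0 T ∈ nhds t := Icc_mem_nhds ht.1 ht.2
  have hgt := (contDiffOn_stripDeriv hT hg (0, 1)).continuousOn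
  obtain ⟨K, hK⟩ := exists_lipschitz_eval hp hd ht l r
  obtain ⟨L, hL0, hL⟩ := exists_bound_on_strip hgt l r
  refine hasDerivAt_integral_sq (S := {s | (∀ x ∈ Icc l r,
      |(p s).eval x - (p t).eval x| ≤ K * |s - t|) ∧ s ∈ Icc 0 T}) (K := L + K) hlr
    (Filter.inter_mem hK hnh) (e := fun s x => g (x, s) - (p s).eval x)
    (fun s hs => (continuous_space_slice hg.continuousOn hs.2).sub (p s).continuous)
    ((continuous_space_slice hgt ht').sub (polyDeriv T k p t).continuous)
    (fun x => ((hasDerivWithinAt_time hg ht').sub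
      (hasDerivWithinAt_eval hp hd ht' x)).hasDerivAt hnh) ?_
  intro s hs x hx
  have h1 := hs.1 x hx
  have h2 : |g (x, s) - g (x, t)| ≤ L * |s - t| :=
    (convex_Icc 0 T).norm_image_sub_le_of_norm_hasDerivWithin_le
      (fun y hy => hasDerivWithinAt_time hg hy) (fun y hy => hL y hy x hx) ht' hs.2
  rw [add_mul]
  calc |g (x, s) - (p s).eval x - (g (x, t) - (p t).eval x)|
      = |(g (x, s) - g (x, t)) - ((p s).eval x - (p t).eval x)| := by congr 1; ring
    _ ≤ _ := (abs_sub _ _).trans (add_le_add h2 h1)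

end PolynomialCurve

/-! ### The error estimate -/

theorem IsPeriodicSolution.pointwise_equation {a b T γ : ℝ} {n : ℕ} {u v : ℝ → ℝ → ℝ} (hT : 0 < T)
    (huv : IsPeriodicSolution a b T γ (n + 1) u v) (x : ℝ) {t : ℝ} (ht : t ∈ Icc 0 T) :
    stripDeriv T (0, 1) (fun p => u p.1 p.2) (x, t)
      + u x t * stripDeriv T (1, 0) (fun p => u p.1 p.2) (x, t) + γ * v x t = 0 := by
  have h1 := (hasDerivWithinAt_time huv.smooth (x := x) ht).derivWithin (uniqueDiffOn_Icc hT t ht)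
  have h2 := hasDerivAt_space huv.smooth (x := x) ht
  have h3 : HasDerivAt (fun y => flux (u y t))
      (u x t * stripDeriv T (1, 0) (fun p => u p.1 p.2) (x, t)) x := by
    refine ((h2.pow 2).div_const 2).congr_deriv ?_
    simp; ring
  have h4 := huv.evolution x t ht
  rw [h3.deriv] at h4
  simp only at h1
  rw [h1] at h4
  exact h4

theorem exists_energy_growth_bound {a b T γ ρ : ℝ} (hab : a < b) (hT : 0 < T) (hρ : 0 < ρ) (k : ℕ)
    {u v : ℝ → ℝ → ℝ} (huv : IsPeriodicSolution a b T γ (k + 1) u v) :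
    ∃ C, 0 ≤ C ∧ ∀ M : Mesh a b, M.IsRegular ρ → M.h ≤ 1 →
      ∀ uh vh : ℝ → M.Broken, M.IsIntegrationDG T γ k uh vh → ∀ t ∈ Icc 0 T,
        ∑ j, ∫ x in M.left j..M.right j, (u x t - (uh t j).eval x) *
          (stripDeriv T (0, 1) (fun p => u p.1 p.2) (x, t) -
            (polyDeriv T k (fun s => uh s j) t).eval x) ≤
        C * ((∑ j, ∫ x in M.left j..M.right j, (u x t - (uh t j).eval x) ^ 2)
          + M.h ^ (2 * k + 1)) := by
  set g : ℝ × ℝ → ℝ := fun p => u p.1 p.2 with hg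
  have hsm : ContDiffOn ℝ (k + 1 : ℕ) g (univ ×ˢ Icc 0 T) := huv.smooth
  have hgx := contDiffOn_stripDeriv hT hsm (1, 0)
  have hgt := contDiffOn_stripDeriv hT hsm (0, 1)
  obtain ⟨B₁, hB₁0, hB₁⟩ := exists_polynomial_approx hT a b (k + 1) g hsm
  obtain ⟨B₂, hB₂0, hB₂⟩ := exists_polynomial_approx hT a b k _ hgt
  obtain ⟨L₁, hL₁0, hL₁⟩ := exists_bound_on_strip hsm.continuousOn a b
  obtain ⟨L₂, hL₂0, hL₂⟩ := exists_bound_on_strip hgx.continuousOn a b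
  obtain ⟨C, hC0, hC⟩ := Mesh.exists_energy_rate_bound (B := B₁ + B₂) (L := L₁ + L₂) γ hab hρ
    (by positivity) k
  refine ⟨C, hC0, fun M hM h1 uh vh hDG t ht => ?_⟩
  have hh := M.h_pos hab
  have hsz0 : ∀ j, 0 ≤ M.right j - M.left j := fun j => (M.size_pos j).le
  have hsz : ∀ j, M.right j - M.left j ≤ M.h := M.size_le_h
  have hpd : ∀ j, ∀ s ∈ Icc 0 T, (uh s j).natDegree ≤ k := fun j s hs => hDG.mem_u s hs j
  refine hC M hM h1 (fun x => u x t) (fun x => stripDeriv T (1, 0) g (x, t))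
    (fun x => stripDeriv T (0, 1) g (x, t)) (fun x => v x t)
    (fun x => hasDerivAt_space hsm ht) (continuous_space_slice hgx.continuousOn ht)
    (continuous_space_slice hgt.continuousOn ht) (fun x => huv.deriv_v x t ht) ?_
    (huv.mean_v t ht) (fun x => huv.pointwise_equation hT x ht)
    (fun x hx => (hL₁ t ht x hx).trans (by linarith))
    (fun x hx => (hL₂ t ht x hx).trans (by linarith)) (fun j => ?_) (fun j => ?_)
    (uh t) (fun j => polyDeriv T k (fun s => uh s j) t) (vh t) (hDG.mem_u t ht)
    (fun j => natDegree_polyOfCoeffs_le _) (fun φ hφ j => ?_) (hDG.integral_v t ht)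
    (hDG.continuous_v t ht) (hDG.mean_v t ht)
  · have := huv.periodic_u t ht a
    simp only [add_sub_cancel] at this
    exact this.symm
  · obtain ⟨q, hqd, hq⟩ := hB₁ t ht _ _ (M.left_lt_right j).le (M.cell_subset j)
    refine ⟨q, natDegree_le_iff_degree_lt_succ.2 hqd, fun x hx => (hq x hx).trans ?_⟩
    have := hsz0 j
    have := hsz j
    gcongr
    linarith
  · obtain ⟨q, hqd, hq⟩ := hB₂ t ht _ _ (M.left_lt_right j).le (M.cell_subset j)
    -- The time derivative has one order of smoothness less, so `q` has degree below `k`, which is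
    -- more than needed; for `k = 0` it is zero.
    refine ⟨q, natDegree_le_iff_degree_le.2 hqd.le, fun x hx => (hq x hx).trans ?_⟩
    have := hsz0 j
    have := hsz j
    gcongr
    linarith
  · have hw := hDG.weak_form t ht φ hφ j
    have : ∀ x, derivWithin (fun s => (uh s j).eval x) (Icc 0 T) t =
        (polyDeriv T k (fun s => uh s j) t).eval x := fun x =>
      (hasDerivWithinAt_eval (hpd j) (hDG.differentiable j) ht x).derivWithin
        (uniqueDiffOn_Icc hT t ht)
    simp only [this] at hw
    exact hw

theorem sq_rpow_add_half {h : ℝ} (hh : 0 < h) (k : ℕ) :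
    (h ^ ((k : ℝ) + 1 / 2)) ^ 2 = h ^ (2 * k + 1) := by
  rw [← Real.rpow_natCast, ← Real.rpow_mul hh.le, ← Real.rpow_natCast]
  congr 1
  push_cast
  ring

end OV
end

theorem theorem2 (a b T γ ρ C₀ : ℝ) (hab : a < b) (hT : 0 < T) (hρ : 0 < ρ) (k : ℕ)
    (u v : ℝ → ℝ → ℝ) (huv : OV.IsPeriodicSolution a b T γ (k + 1) u v) :
    ∃ C > 0, ∃ h₀ > 0, ∀ M : OV.Mesh a b, M.IsRegular ρ → M.h ≤ h₀ →
      ∀ uh vh : ℝ → M.Broken, M.IsIntegrationDG T γ k uh vh →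
        M.l2Error (fun x => u x 0) (uh 0) ≤ C₀ * M.h ^ ((k : ℝ) + 1 / 2) →
        ∀ t ∈ Set.Icc 0 T,
          M.l2Error (fun x => u x t) (uh t) ≤ C * M.h ^ ((k : ℝ) + 1 / 2) := by
  obtain ⟨C, hC0, hC⟩ := OV.exists_energy_growth_bound hab hT hρ k huv
  -- `2 * C` is the Grönwall rate, since the energy has derivative `2 ∫ e e_t`. Initially energy
  -- plus `H` is at most `(C₀ ^ 2 + 1) * H`.
  refine ⟨√(Real.exp (2 * C * T) * (C₀ ^ 2 + 1)), by positivity, 1, one_pos, ?_⟩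
  intro M hM h1 uh vh hDG hinit t ht
  have hh := M.h_pos hab
  have hpd : ∀ j, ∀ s ∈ Icc 0 T, (uh s j).natDegree ≤ k := fun j s hs => hDG.mem_u s hs j
  have hsm : ContDiffOn ℝ (k + 1 : ℕ) (fun p : ℝ × ℝ => u p.1 p.2) (univ ×ˢ Icc 0 T) := huv.smooth
  set E : ℝ → ℝ := fun s => ∑ j, ∫ x in M.left j..M.right j, (u x s - (uh s j).eval x) ^ 2 with hE
  set H := M.h ^ (2 * k + 1) with hH
  have hH0 : 0 ≤ H := by positivity
  have hE0 : ∀ s, 0 ≤ E s := fun s => Finset.sum_nonneg fun j _ =>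
    intervalIntegral.integral_nonneg (M.left_lt_right j).le fun _ _ => sq_nonneg _
  have hEc : ContinuousOn E (Icc 0 T) := continuousOn_finsetSum _ fun j _ =>
    OV.continuousOn_integral_sq hT.le
      (hsm.continuousOn.sub (OV.continuousOn_eval (hpd j) (hDG.differentiable j)))
  have hEd : ∀ s ∈ Ioo 0 T, HasDerivAt E (∑ j, 2 * ∫ x in M.left j..M.right j,
      (u x s - (uh s j).eval x) * (OV.stripDeriv T (0, 1) (fun p => u p.1 p.2) (x, s) -
        (OV.polyDeriv T k (fun s => uh s j) s).eval x)) s := fun s hs =>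
    HasDerivAt.fun_sum fun j _ =>
      OV.hasDerivAt_cell_energy hT hsm (hpd j) (hDG.differentiable j) hs (M.left_lt_right j).le
  have hgr := OV.gronwall_energy (C := 2 * C) (H := H) hEc hEd (fun s hs => by
    rw [← Finset.mul_sum, mul_assoc]
    exact mul_le_mul_of_nonneg_left (hC M hM h1 uh vh hDG s (Ioo_subset_Icc_self hs)) zero_le_two)
    ht
  have hinit2 : E 0 ≤ C₀ ^ 2 * H := by
    have hl : M.l2Error (fun x => u x 0) (uh 0) = √(E 0) := rfl
    rw [hl] at hinit
    calc E 0 = √(E 0) ^ 2 := (Real.sq_sqrt (hE0 0)).symm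
      _ ≤ (C₀ * M.h ^ ((k : ℝ) + 1 / 2)) ^ 2 := by gcongr
      _ = C₀ ^ 2 * H := by rw [mul_pow, OV.sq_rpow_add_half hh]
  have hl : M.l2Error (fun x => u x t) (uh t) = √(E t) := rfl
  rw [hl]
  refine Real.sqrt_le_iff.2 ⟨by positivity, ?_⟩
  rw [mul_pow, OV.sq_rpow_add_half hh, Real.sq_sqrt (by positivity)]
  calc E t ≤ E t + H := by linarith
    _ ≤ Real.exp (2 * C * t) * (E 0 + H) := hgr
    _ ≤ Real.exp (2 * C * T) * (C₀ ^ 2 * H + H) := by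
        have := ht.2
        have := hE0 0
        gcongr
    _ = _ := by ring
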